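/- Let $0<r<1$, $\alpha>0$ and $\beta\in\mathbb{R}$. Let $C^{\alpha,r}_{\beta,\infty}$ be the set of all $2\pi$-periodic functions $f$ that can be represented for all $x\in\mathbb{R}$ in the form $$f(x)=\frac{a_0}{2}+\frac1\pi\int_{-\pi}^{\pi}P_{\alpha,r,\beta}(x-t)\varphi(t)\,dt,\qquad P_{\alpha,r,\beta}(t)=\sum_{k=1}^{\infty}e^{-\alpha k^{r}}\cos\Big(kt-\frac{\beta\pi}{2}\Big),$$ where $a_0\in\mathbb{R}$ and $\varphi$ is a measurable $2\pi$-periodic function with $\operatorname{ess\,sup}_t|\varphi(t)|\le 1$ and $\int_{-\pi}^{\pi}\varphi(t)\,dt=0$. For $n\in\mathbb{N}$, $n\ge 1$, put $$\mathcal{E}_n(C^{\alpha,r}_{\beta,\infty})_C=\sup_{f\in C^{\alpha,r}_{\beta,\infty}}\ \max_{x\in\mathbb{R}}|f(x)-S_{n-1}(f;x)|,$$ where $S_{n-1}(f;\cdot)$ is the partial Fourier sum of order $n-1$ of $f$. Let $n_1=n_1(\alpha,r)$ be the smallest positive integer $n$ such that $$\frac{1}{\alpha r}\,\frac{1}{n^{r}}\Big(1+\ln\Big(\frac{\pi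 n^{1-r}}{\alpha r}\Big)\Big)+\frac{\alpha r}{n^{1-r}}\le\frac{1}{(3\pi)^3}.$$ Then for every integer $n\ge n_1(\alpha,r)$ the quantity $\mathcal{E}_n(C^{\alpha,r}_{\beta,\infty})_C$ is finite and $$\mathcal{E}_n(C^{\alpha,r}_{\beta,\infty})_C=\frac{4}{\pi^2}\,e^{-\alpha n^{r}}\ln\Big(\frac{\pi n^{1-r}}{\alpha r}\Big)+\gamma\,e^{-\alpha n^{r}},$$ where the quantity $\gamma=\gamma_n(\alpha,r,\beta)$ satisfies $|\gamma|\le 20\pi^4$. -/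

import Mathlib

open MeasureTheory Filter
open scoped Real ENNReal

namespace FourierApprox

/-- The generalized Poisson kernel
`P_{α,r,β}(t) = ∑_{k ≥ 1} exp (-α k ^ r) cos (k t - β π / 2)`
(an absolutely convergent series for `α, r > 0`). -/
noncomputable def poissonKernel (α r β t : ℝ) : ℝ :=
  ∑' k : ℕ, Real.exp (-α * ((k : ℝ) + 1) ^ r) * Real.cos (((k : ℝ) + 1) * t - β * π / 2)

/-- The set `B_p^0` of `2π`-periodic functions with `‖φ‖_p ≤ 1` over a period and with
mean value zero. -/
def zeroMeanBall (p : ℝ≥0∞) : Set (ℝ → ℝ) :=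
  {φ | Function.Periodic φ (2 * π) ∧
    AEStronglyMeasurable φ (volume.restrict (Set.Ioc (-π) π)) ∧
    eLpNorm φ p (volume.restrict (Set.Ioc (-π) π)) ≤ 1 ∧
    ∫ t in (-π)..π, φ t = 0}

/-- The class `C^{α,r}_{β,p}` of generalized Poisson integrals. -/
def poissonClass (α r β : ℝ) (p : ℝ≥0∞) : Set (ℝ → ℝ) :=
  {f | ∃ a₀ : ℝ, ∃ φ ∈ zeroMeanBall p, ∀ x : ℝ,
    f x = a₀ / 2 + 1 / π * ∫ t in (-π)..π, poissonKernel α r β (x - t) * φ t}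

/-- Cosine Fourier coefficient `a_k(f)`. -/
noncomputable def cosCoeff (f : ℝ → ℝ) (k : ℕ) : ℝ :=
  1 / π * ∫ t in (-π)..π, f t * Real.cos (k * t)

/-- Sine Fourier coefficient `b_k(f)`. -/
noncomputable def sinCoeff (f : ℝ → ℝ) (k : ℕ) : ℝ :=
  1 / π * ∫ t in (-π)..π, f t * Real.sin (k * t)

/-- The partial Fourier sum `S_m(f; x)` of order `m`. -/
noncomputable def fourierSum (m : ℕ) (f : ℝ → ℝ) (x : ℝ) : ℝ :=
  cosCoeff f 0 / 2 +
    ∑ k ∈ Finset.Icc 1 m, (cosCoeff f k * Real.cos (k * x) + sinCoeff f k * Real.sin (k * x))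

/-- The uniform norm `sup_x |g x|`, with values in `[0, ∞]`. -/
noncomputable def uniformNorm (g : ℝ → ℝ) : ℝ≥0∞ :=
  ⨆ x : ℝ, ENNReal.ofReal |g x|

/-- For `n ≥ 1`, the quantity `sup_{f ∈ C^{α,r}_{β,p}} ‖f - S_{n-1}(f)‖_C`, with values
in `[0, ∞]`. -/
noncomputable def fourierError (α r β : ℝ) (p : ℝ≥0∞) (n : ℕ) : ℝ≥0∞ :=
  ⨆ f ∈ poissonClass α r β p, uniformNorm (fun x => f x - fourierSum (n - 1) f x)

/-- The condition on positive integers that defines the threshold. -/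
def ThresholdCond (α r : ℝ) (n : ℕ) : Prop :=
  1 ≤ n ∧
    1 / (α * r) * (1 / (n : ℝ) ^ r) * (1 + Real.log (π * (n : ℝ) ^ (1 - r) / (α * r))) +
      α * r / (n : ℝ) ^ (1 - r) ≤ 1 / (3 * π) ^ 3

/-- The smallest positive integer that satisfies the condition. -/
noncomputable def threshold (α r : ℝ) : ℕ :=
  sInf {n : ℕ | ThresholdCond α r n}

/-- The infimum above is attained, so it is a minimum. -/
theorem threshold_isLeast {α r : ℝ} (hα : 0 < α) (hr : 0 < r) (hr1 : r < 1) :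
    IsLeast {n : ℕ | ThresholdCond α r n} (threshold α r) := by
  have hc : 0 < α * r := mul_pos hα hr
  have h1 : Tendsto (fun x : ℝ => 1 / x ^ r) atTop (nhds 0) := by
    simp only [one_div]
    exact (tendsto_rpow_atTop hr).inv_tendsto_atTop
  have h2 : Tendsto (fun x : ℝ => Real.log x / x ^ r) atTop (nhds 0) :=
    (isLittleO_log_rpow_atTop hr).tendsto_div_nhds_zero
  have h3 : Tendsto (fun x : ℝ => 1 / x ^ (1 - r)) atTop (nhds 0) := by
    simp only [one_div]
    exact (tendsto_rpow_atTop (sub_pos.2 hr1)).inv_tendsto_atTop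
  have h4 := (((h1.const_mul (1 / (α * r) * (1 + Real.log (π / (α * r))))).add
    (h2.const_mul (1 / (α * r) * (1 - r)))).add (h3.const_mul (α * r))).comp
      (tendsto_natCast_atTop_atTop (R := ℝ))
  have hε : (0 : ℝ) < 1 / (3 * π) ^ 3 := by positivity
  have h5 := h4.eventually (eventually_le_nhds (b := 1 / (3 * π) ^ 3) (by simpa using hε))
  obtain ⟨n, hn, hn1⟩ := (h5.and (eventually_ge_atTop 1)).exists
  have hne : {n : ℕ | ThresholdCond α r n}.Nonempty := by
    refine ⟨n, hn1, le_trans (le_of_eq ?_) hn⟩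
    have hn0 : (0 : ℝ) < n := by exact_mod_cast hn1
    have hlog : Real.log (π * (n : ℝ) ^ (1 - r) / (α * r)) =
        Real.log (π / (α * r)) + (1 - r) * Real.log n := by
      rw [mul_div_right_comm, Real.log_mul (by positivity) (by positivity),
        Real.log_rpow hn0]
    rw [hlog]
    simp only [Function.comp]
    ring
  exact ⟨Nat.sInf_mem hne, fun m hm => Nat.sInf_le hm⟩

end FourierApprox

/-!
Convolution acts diagonally on frequencies, so the remainder `f - S_{n-1} f` is the convolution of
`φ / π` with the part `K` of the kernel of frequencies at least `n`. Its coefficients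
`ψ(k) = exp (-α k ^ r)`, `k ≥ n`, are convex and decay like `ψ(n) exp (-(k - n) / M)` on the scale
`M = n ^ (1 - r) / (α r)`. Two Abel summations show that `K(t) = -ψ(n) sin (n t - θ) / t` for
`|t| ≥ 1 / M`, while `|K| ≤ (1 + 2 M) ψ(n)` near zero, both up to an error whose `L¹` norm is
`O(ψ(n))`. As `|sin|` has mean `2 / π`, the `L¹` norm of the main term is
`(4 / π) log (π M) ψ(n) + O(ψ(n))`. This norm divided by `π` bounds the remainder from above. It is
attained up to `O(ψ(n))` by the sign of the main term, whose small mean can be subtracted without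
changing the integral against `K`, because `K` itself has mean zero.
-/

namespace FourierApprox

section Abel

variable {c : ℕ → ℝ} {z : ℂ}

lemma summable_ofReal_mul_pow (hc : Summable c) (hz : ‖z‖ = 1) :
    Summable fun j => (c j : ℂ) * z ^ j :=
  .of_norm <| by simpa [hz] using hc.abs

lemma one_sub_mul_tsum_ofReal_mul_pow (hc : Summable c) (hz : ‖z‖ = 1) :
    (1 - z) * ∑' j, (c j : ℂ) * z ^ j =
      c 0 - z * ∑' j, ((c j - c (j + 1) : ℝ) : ℂ) * z ^ j := by
  have hs := summable_ofReal_mul_pow hc hz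
  have hs' := summable_ofReal_mul_pow ((summable_nat_add_iff 1).2 hc) hz
  have hshift : ∑' j, (c j : ℂ) * z ^ j = c 0 + z * ∑' j, (c (j + 1) : ℂ) * z ^ j := by
    rw [hs.tsum_eq_zero_add, ← tsum_mul_left]
    simp only [pow_zero, mul_one, pow_succ']
    congr! 3
    ring
  have hdiff : ∑' j, ((c j - c (j + 1) : ℝ) : ℂ) * z ^ j =
      ∑' j, (c j : ℂ) * z ^ j - ∑' j, (c (j + 1) : ℂ) * z ^ j := by
    rw [← hs.tsum_sub hs']
    simp only [Complex.ofReal_sub, sub_mul]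
  rw [hdiff]
  linear_combination hshift

lemma nonneg_of_antitone_of_summable (hc : Summable c) (hanti : Antitone c) (j : ℕ) : 0 ≤ c j :=
  hanti.le_of_tendsto hc.tendsto_atTop_zero j

lemma summable_sub_succ (hc : Summable c) : Summable fun j => c j - c (j + 1) :=
  hc.sub ((summable_nat_add_iff 1).2 hc)

lemma antitone_of_antitone_sub_succ (hc : Summable c)
    (hconv : Antitone fun j => c j - c (j + 1)) : Antitone c :=
  antitone_nat_of_succ_le fun j =>
    sub_nonneg.1 (nonneg_of_antitone_of_summable (summable_sub_succ hc) hconv j)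

lemma norm_tsum_ofReal_mul_pow_le (hc : Summable c) (hanti : Antitone c) (hz : ‖z‖ = 1)
    (hz1 : z ≠ 1) : ‖∑' j, (c j : ℂ) * z ^ j‖ ≤ 2 * c 0 / ‖1 - z‖ := by
  have hpos : 0 < ‖1 - z‖ := norm_pos_iff.2 (sub_ne_zero.2 hz1.symm)
  have htele : HasSum (fun j => c j - c (j + 1)) (c 0) := by
    have h := hc.hasSum.sub ((summable_nat_add_iff 1).2 hc).hasSum
    rwa [hc.tsum_eq_zero_add, add_sub_cancel_right] at h
  have hdiff : ‖∑' j, ((c j - c (j + 1) : ℝ) : ℂ) * z ^ j‖ ≤ c 0 :=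
    tsum_of_norm_bounded htele fun j => by
      rw [norm_mul, norm_pow, hz, one_pow, mul_one, Complex.norm_real,
        Real.norm_of_nonneg (sub_nonneg.2 (hanti j.le_succ))]
  rw [le_div_iff₀' hpos, ← norm_mul, one_sub_mul_tsum_ofReal_mul_pow hc hz]
  calc ‖(c 0 : ℂ) - z * ∑' j, ((c j - c (j + 1) : ℝ) : ℂ) * z ^ j‖
      ≤ ‖(c 0 : ℂ)‖ + ‖z * ∑' j, ((c j - c (j + 1) : ℝ) : ℂ) * z ^ j‖ := norm_sub_le _ _
    _ ≤ c 0 + c 0 := by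
        rw [norm_mul, hz, one_mul, Complex.norm_real,
          Real.norm_of_nonneg (nonneg_of_antitone_of_summable hc hanti 0)]
        gcongr
    _ = 2 * c 0 := (two_mul _).symm

lemma norm_tsum_ofReal_mul_pow_sub_le (hc : Summable c)
    (hconv : Antitone fun j => c j - c (j + 1)) (hz : ‖z‖ = 1) (hz1 : z ≠ 1) :
    ‖∑' j, (c j : ℂ) * z ^ j - c 0 / (1 - z)‖ ≤ 2 * (c 0 - c 1) / ‖1 - z‖ ^ 2 := by
  have hne : 1 - z ≠ 0 := sub_ne_zero.2 hz1.symm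
  have habel : ∑' j, (c j : ℂ) * z ^ j - c 0 / (1 - z) =
      -z * (∑' j, ((c j - c (j + 1) : ℝ) : ℂ) * z ^ j) / (1 - z) := by
    rw [eq_div_iff hne, sub_mul, div_mul_cancel₀ _ hne]
    linear_combination one_sub_mul_tsum_ofReal_mul_pow hc hz
  calc ‖∑' j, (c j : ℂ) * z ^ j - c 0 / (1 - z)‖
      = ‖∑' j, ((c j - c (j + 1) : ℝ) : ℂ) * z ^ j‖ / ‖1 - z‖ := by
        rw [habel, norm_div, norm_mul, norm_neg, hz, one_mul]
    _ ≤ 2 * (c 0 - c 1) / ‖1 - z‖ / ‖1 - z‖ := by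
        gcongr
        exact norm_tsum_ofReal_mul_pow_le (summable_sub_succ hc) hconv hz hz1
    _ = 2 * (c 0 - c 1) / ‖1 - z‖ ^ 2 := by rw [div_div, sq]

end Abel

lemma norm_exp_I_mul_sub_one_sub_le (t : ℝ) :
    ‖Complex.exp (Complex.I * t) - 1 - Complex.I * t‖ ≤ 2 * t ^ 2 := by
  have hnorm : ‖Complex.I * (t : ℂ)‖ = |t| := by simp
  rcases le_or_gt |t| 1 with ht | ht
  · calc ‖Complex.exp (Complex.I * t) - 1 - Complex.I * t‖ ≤ ‖Complex.I * (t : ℂ)‖ ^ 2 :=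
          Complex.norm_exp_sub_one_sub_id_le (hnorm.trans_le ht)
      _ ≤ 2 * t ^ 2 := by rw [hnorm, sq_abs]; linarith [sq_nonneg t]
  · calc ‖Complex.exp (Complex.I * t) - 1 - Complex.I * t‖
        ≤ ‖Complex.exp (Complex.I * t) - 1‖ + ‖Complex.I * (t : ℂ)‖ := norm_sub_le _ _
      _ ≤ |t| + |t| := add_le_add Real.norm_exp_I_mul_ofReal_sub_one_le hnorm.le
      _ ≤ 2 * t ^ 2 := by rw [← sq_abs]; nlinarith

lemma le_norm_one_sub_exp_I_mul {t : ℝ} (ht : |t| ≤ π) :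
    2 / π * |t| ≤ ‖1 - Complex.exp (Complex.I * t)‖ := by
  have hhalf : |t / 2| = |t| / 2 := by rw [abs_div, abs_two]
  have hsin : 2 / π * |t / 2| ≤ |Real.sin (t / 2)| :=
    Real.mul_abs_le_abs_sin (by rw [hhalf]; linarith)
  rw [norm_sub_rev, Complex.norm_exp_I_mul_ofReal_sub_one, norm_mul, Real.norm_eq_abs,
    Real.norm_eq_abs, abs_two]
  rw [hhalf] at hsin
  linarith

lemma norm_inv_one_sub_exp_I_mul_sub_le {t : ℝ} (ht0 : t ≠ 0) (ht : |t| ≤ π) :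
    ‖1 / (1 - Complex.exp (Complex.I * t)) - Complex.I / t‖ ≤ π := by
  have hlow := le_norm_one_sub_exp_I_mul ht
  have hpos : 0 < 2 / π * |t| := by positivity
  have hne : 1 - Complex.exp (Complex.I * t) ≠ 0 := norm_pos_iff.1 (hpos.trans_le hlow)
  have htC : (t : ℂ) ≠ 0 := Complex.ofReal_ne_zero.2 ht0
  have hcombine : 1 / (1 - Complex.exp (Complex.I * t)) - Complex.I / t =
      Complex.I * (Complex.exp (Complex.I * t) - 1 - Complex.I * t) /
        (t * (1 - Complex.exp (Complex.I * t))) := by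
    field_simp
    linear_combination (t : ℂ) * Complex.I_sq
  calc ‖1 / (1 - Complex.exp (Complex.I * t)) - Complex.I / t‖
      = ‖Complex.exp (Complex.I * t) - 1 - Complex.I * t‖ /
          (|t| * ‖1 - Complex.exp (Complex.I * t)‖) := by
        rw [hcombine, norm_div, norm_mul, norm_mul, Complex.norm_I, one_mul, Complex.norm_real,
          Real.norm_eq_abs]
    _ ≤ 2 * t ^ 2 / (|t| * (2 / π * |t|)) := by
        gcongr
        exact norm_exp_I_mul_sub_one_sub_le t
    _ = π := by
        rw [← sq_abs]
        field_simp

/-- The kernel `∑_{k ≥ n} ψ(k) cos (k t - θ)`, which is the part of frequencies at least `n` of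
the kernel of the convolution class given by the multiplier `ψ` and the phase `θ`. -/
noncomputable def cosKernel (ψ : ℕ → ℝ) (θ : ℝ) (n : ℕ) (t : ℝ) : ℝ :=
  ∑' j : ℕ, ψ (n + j) * Real.cos ((n + j : ℕ) * t - θ)

section CosKernel

variable {ψ : ℕ → ℝ}

lemma summable_tail (hψ : Summable ψ) (n : ℕ) : Summable fun j => ψ (n + j) :=
  hψ.comp_injective (add_right_injective n)

lemma abs_mul_cos_le (a u : ℝ) : |a * Real.cos u| ≤ |a| := by
  rw [abs_mul]
  exact mul_le_of_le_one_right (abs_nonneg a) (Real.abs_cos_le_one u)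

lemma continuous_cosKernel (hψ : Summable ψ) (θ : ℝ) (n : ℕ) : Continuous (cosKernel ψ θ n) :=
  continuous_tsum (fun j => by fun_prop) (summable_tail hψ n).abs fun _ _ => abs_mul_cos_le _ _

lemma abs_cosKernel_le (hψ : Summable ψ) (θ : ℝ) (n : ℕ) (t : ℝ) :
    |cosKernel ψ θ n t| ≤ ∑' j, |ψ (n + j)| := by
  rw [← Real.norm_eq_abs]
  exact tsum_of_norm_bounded (summable_tail hψ n).abs.hasSum fun _ => abs_mul_cos_le _ _

lemma cosKernel_neg (ψ : ℕ → ℝ) (θ : ℝ) (n : ℕ) (t : ℝ) :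
    cosKernel ψ θ n (-t) = cosKernel ψ (-θ) n t := by
  unfold cosKernel
  congr! 3 with j
  rw [← Real.cos_neg]
  ring_nf

lemma cosKernel_periodic (ψ : ℕ → ℝ) (θ : ℝ) (n : ℕ) :
    Function.Periodic (cosKernel ψ θ n) (2 * π) := fun t => by
  unfold cosKernel
  congr! 3 with j
  rw [mul_add, add_sub_right_comm, Real.cos_add_nat_mul_two_pi]

lemma cosKernel_eq_re (hψ : Summable ψ) (θ : ℝ) (n : ℕ) (t : ℝ) :
    cosKernel ψ θ n t = (Complex.exp ((n * t - θ : ℝ) * Complex.I) *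
      ∑' j, (ψ (n + j) : ℂ) * Complex.exp (Complex.I * t) ^ j).re := by
  have hs : Summable fun j => (ψ (n + j) : ℂ) * Complex.exp (Complex.I * t) ^ j :=
    summable_ofReal_mul_pow (summable_tail hψ n) (Complex.norm_exp_I_mul_ofReal t)
  rw [← tsum_mul_left, Complex.re_tsum (hs.mul_left _)]
  unfold cosKernel
  congr! 2 with j
  rw [mul_left_comm, Complex.re_ofReal_mul, ← Complex.exp_nat_mul, ← Complex.exp_add,
    ← Complex.exp_ofReal_mul_I_re]
  push_cast
  ring_nf

end CosKernel

/-- From the index `n` on, the coefficients `ψ` form a summable convex sequence that behaves like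
the geometric sequence `ψ(n) exp (-j / M)`: it loses at most the proportion `1 / M` in the first
step and its sum is at most about `2 M ψ(n)`. The scale `M` is at least one but small compared
to `n`. -/
structure ConvexTail (ψ : ℕ → ℝ) (n : ℕ) (M : ℝ) : Prop where
  summable : Summable ψ
  antitone_sub_succ : Antitone fun j => ψ (n + j) - ψ (n + (j + 1))
  sub_succ_le : ψ n - ψ (n + 1) ≤ ψ n / M
  tsum_le : ∑' j, ψ (n + j) ≤ (1 + 2 * M) * ψ n
  one_le : 1 ≤ M
  two_mul_le : 2 * M ≤ n

/-- The approximation `-sin (n t - θ) / t` of the normalized kernel `cosKernel ψ θ n / ψ n`, cut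
off at the distance `δ` from its singularity. -/
noncomputable def mainTerm (n : ℕ) (θ δ t : ℝ) : ℝ :=
  if δ ≤ |t| then -(Real.sin (n * t - θ) / t) else 0

namespace ConvexTail

variable {ψ : ℕ → ℝ} {n : ℕ} {M : ℝ}

lemma nonneg (h : ConvexTail ψ n M) (j : ℕ) : 0 ≤ ψ (n + j) :=
  have hs := summable_tail h.summable n
  nonneg_of_antitone_of_summable hs (antitone_of_antitone_sub_succ hs h.antitone_sub_succ) j

lemma abs_cosKernel_le (h : ConvexTail ψ n M) (θ t : ℝ) :
    |cosKernel ψ θ n t| ≤ ψ n * (1 + 2 * M) := by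
  have hsum := FourierApprox.abs_cosKernel_le h.summable θ n t
  simp only [abs_of_nonneg (h.nonneg _)] at hsum
  linarith [h.tsum_le]

lemma abs_cosKernel_add_le (h : ConvexTail ψ n M) (θ : ℝ) {t : ℝ} (ht0 : t ≠ 0) (ht : |t| ≤ π) :
    |cosKernel ψ θ n t + ψ n * (Real.sin (n * t - θ) / t)| ≤
      ψ n * (π + π ^ 2 / (2 * M * t ^ 2)) := by
  have hM : 0 < M := zero_lt_one.trans_le h.one_le
  have hψn : 0 ≤ ψ n := h.nonneg 0
  set z : ℂ := Complex.exp (Complex.I * t) with hz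
  set S : ℂ := ∑' j, (ψ (n + j) : ℂ) * z ^ j with hS
  have hlow : 2 / π * |t| ≤ ‖1 - z‖ := le_norm_one_sub_exp_I_mul ht
  have hpos : 0 < 2 / π * |t| := by positivity
  have hz1 : z ≠ 1 := (sub_ne_zero.1 (norm_pos_iff.1 (hpos.trans_le hlow))).symm
  have hphase : cosKernel ψ θ n t + ψ n * (Real.sin (n * t - θ) / t) =
      (Complex.exp ((n * t - θ : ℝ) * Complex.I) * (S - ψ n * (Complex.I / t))).re := by
    rw [cosKernel_eq_re h.summable, mul_sub, Complex.sub_re, ← hz, ← hS, sub_eq_add_neg]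
    congr 1
    rw [mul_left_comm, Complex.re_ofReal_mul, ← mul_div_assoc _ Complex.I,
      Complex.div_ofReal_re, Complex.mul_I_re, Complex.exp_ofReal_mul_I_im]
    ring
  have habel : ‖S - ψ n / (1 - z)‖ ≤ ψ n * (π ^ 2 / (2 * M * t ^ 2)) := calc
    ‖S - ψ n / (1 - z)‖ ≤ 2 * (ψ n - ψ (n + 1)) / ‖1 - z‖ ^ 2 :=
        norm_tsum_ofReal_mul_pow_sub_le (summable_tail h.summable n) h.antitone_sub_succ
          (Complex.norm_exp_I_mul_ofReal t) hz1
    _ ≤ 2 * (ψ n / M) / (2 / π * |t|) ^ 2 := by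
        gcongr
        exact h.sub_succ_le
    _ = ψ n * (π ^ 2 / (2 * M * t ^ 2)) := by
        rw [← sq_abs t]
        field_simp
  have hpole : ‖ψ n / (1 - z) - ψ n * (Complex.I / t)‖ ≤ ψ n * π := by
    rw [div_eq_mul_one_div, ← mul_sub, norm_mul, Complex.norm_real, Real.norm_of_nonneg hψn]
    exact mul_le_mul_of_nonneg_left (norm_inv_one_sub_exp_I_mul_sub_le ht0 ht) hψn
  calc |cosKernel ψ θ n t + ψ n * (Real.sin (n * t - θ) / t)|
      ≤ ‖S - ψ n * (Complex.I / t)‖ := by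
        rw [hphase]
        refine (Complex.abs_re_le_norm _).trans_eq ?_
        rw [norm_mul, Complex.norm_exp_ofReal_mul_I, one_mul]
    _ ≤ ‖S - ψ n / (1 - z)‖ + ‖ψ n / (1 - z) - ψ n * (Complex.I / t)‖ :=
        norm_sub_le_norm_sub_add_norm_sub _ _ _
    _ ≤ ψ n * (π + π ^ 2 / (2 * M * t ^ 2)) := by linarith

lemma abs_cosKernel_sub_mainTerm_le (h : ConvexTail ψ n M) (θ : ℝ) {t : ℝ} (ht : |t| ≤ π) :
    |cosKernel ψ θ n t - ψ n * mainTerm n θ M⁻¹ t| ≤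
      ψ n * (π + π ^ 2 * M * (1 + (M * t) ^ 2)⁻¹) := by
  have hM : 0 < M := zero_lt_one.trans_le h.one_le
  have hψn : 0 ≤ ψ n := h.nonneg 0
  have hπ := Real.pi_gt_three
  unfold mainTerm
  split_ifs with hfar
  · have ht0 : 0 < |t| := (inv_pos.2 hM).trans_le hfar
    have hone : 1 ≤ (M * t) ^ 2 := by
      rw [one_le_sq_iff_one_le_abs, abs_mul, abs_of_pos hM]
      exact (inv_le_iff_one_le_mul₀' hM).1 hfar
    have ht2 : t ≠ 0 := abs_pos.1 ht0
    rw [mul_neg, sub_neg_eq_add]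
    refine (h.abs_cosKernel_add_le θ ht2 ht).trans ?_
    gcongr ψ n * (π + ?_)
    rw [← div_eq_mul_inv, div_le_div_iff₀ (by positivity) (by positivity)]
    nlinarith [mul_nonneg (sq_nonneg π) (sub_nonneg.2 hone)]
  · have hnear : (M * t) ^ 2 ≤ 1 := by
      rw [sq_le_one_iff_abs_le_one, abs_mul, abs_of_pos hM]
      exact ((lt_inv_mul_iff₀ hM).1 (by simpa using not_le.1 hfar)).le
    have hhalf : 2⁻¹ ≤ (1 + (M * t) ^ 2)⁻¹ := by
      gcongr
      linarith
    rw [mul_zero, sub_zero]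
    refine (h.abs_cosKernel_le θ t).trans ?_
    gcongr ψ n * ?_
    have hπ2 : 4 ≤ π ^ 2 := by nlinarith
    nlinarith [mul_le_mul_of_nonneg_left hhalf (by positivity : 0 ≤ π ^ 2 * M),
      mul_le_mul_of_nonneg_right hπ2 hM.le]

end ConvexTail

lemma intervalIntegrable_of_abs_le {g : ℝ → ℝ} {C : ℝ} (hg : Measurable g) (hC : ∀ x, |g x| ≤ C)
    (a b : ℝ) : IntervalIntegrable g volume a b :=
  (intervalIntegrable_const (c := C)).mono_fun hg.aestronglyMeasurable
    (ae_of_all _ fun x => (hC x).trans (le_abs_self C))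

lemma hasSum_integral_tsum_mul {w : ℕ → ℝ} (hw : Summable w) {g : ℕ → ℝ → ℝ}
    (hg : ∀ k, Continuous (g k)) (hgw : ∀ k t, |g k t| ≤ w k) {φ : ℝ → ℝ} {a b : ℝ}
    (hφ : IntervalIntegrable φ volume a b) :
    HasSum (fun k => ∫ t in a..b, g k t * φ t) (∫ t in a..b, (∑' k, g k t) * φ t) := by
  refine intervalIntegral.hasSum_integral_of_dominated_convergence (fun k t => w k * |φ t|)
    (fun k => (hg k).aestronglyMeasurable.mul (intervalIntegrable_iff.1 hφ).aestronglyMeasurable)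
    (fun k => ae_of_all _ fun t _ => ?_) (ae_of_all _ fun t _ => hw.mul_right _) ?_
    (ae_of_all _ fun t _ => ?_)
  · rw [norm_mul, Real.norm_eq_abs, Real.norm_eq_abs]
    exact mul_le_mul_of_nonneg_right (hgw k t) (abs_nonneg _)
  · simp_rw [tsum_mul_right]
    exact hφ.abs.const_mul _
  · exact (Summable.of_norm_bounded hw fun k => hgw k t).hasSum.mul_right (φ t)

lemma integral_cos_intCast_mul_sub {j : ℤ} (hj : j ≠ 0) (a : ℝ) :
    ∫ t in (-π)..π, Real.cos (j * t - a) = 0 := by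
  rw [intervalIntegral.integral_comp_mul_sub _ (Int.cast_ne_zero.2 hj), integral_cos,
    mul_neg, Real.sin_sub, Real.sin_sub, Real.sin_neg, Real.cos_neg, Real.sin_int_mul_pi]
  simp

lemma integral_cosKernel_mul {ψ : ℕ → ℝ} (hψ : Summable ψ) (θ : ℝ) (n : ℕ) (x : ℝ) {φ : ℝ → ℝ}
    {a b : ℝ} (hφ : IntervalIntegrable φ volume a b) :
    ∫ t in a..b, cosKernel ψ θ n (x - t) * φ t =
      ∑' j, ψ (n + j) * ∫ t in a..b, Real.cos ((n + j : ℕ) * (x - t) - θ) * φ t := by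
  have h := hasSum_integral_tsum_mul (summable_tail hψ n).abs
    (g := fun j t => ψ (n + j) * Real.cos ((n + j : ℕ) * (x - t) - θ)) (fun j => by fun_prop)
    (fun _ _ => abs_mul_cos_le _ _) hφ
  simp only [mul_assoc, intervalIntegral.integral_const_mul] at h
  exact h.tsum_eq.symm

lemma integral_cosKernel {ψ : ℕ → ℝ} (hψ : Summable ψ) (θ : ℝ) {n : ℕ} (hn : n ≠ 0) :
    ∫ t in (-π)..π, cosKernel ψ θ n t = 0 := by
  have h := integral_cosKernel_mul hψ (-θ) n 0
    (intervalIntegrable_const (c := (1 : ℝ)) (a := -π) (b := π))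
  have hterm (j : ℕ) : ∫ t in (-π)..π, Real.cos ((n + j : ℕ) * -t + θ) = 0 := by
    refine Eq.trans ?_ (integral_cos_intCast_mul_sub (j := (n + j : ℕ)) (by omega) θ)
    congr! 2 with t
    rw [← Real.cos_neg, Int.cast_natCast]
    ring_nf
  simpa only [zero_sub, cosKernel_neg, neg_neg, mul_one, sub_neg_eq_add, hterm, mul_zero,
    tsum_zero] using h

section MainTerm

variable {δ : ℝ}

lemma measurable_mainTerm (n : ℕ) (θ δ : ℝ) : Measurable (mainTerm n θ δ) :=
  .ite (measurableSet_le measurable_const measurable_abs) (by fun_prop) measurable_const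

lemma abs_mainTerm_le (n : ℕ) (θ : ℝ) (hδ : 0 < δ) (t : ℝ) : |mainTerm n θ δ t| ≤ δ⁻¹ := by
  unfold mainTerm
  split_ifs with h
  · rw [abs_neg, abs_div, ← one_div]
    gcongr
    exact Real.abs_sin_le_one _
  · simpa using hδ.le

lemma intervalIntegrable_mainTerm (n : ℕ) (θ : ℝ) (hδ : 0 < δ) (a b : ℝ) :
    IntervalIntegrable (mainTerm n θ δ) volume a b :=
  intervalIntegrable_of_abs_le (measurable_mainTerm n θ δ) (abs_mainTerm_le n θ hδ) a b

end MainTerm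

lemma integral_mul_inv_one_add_sq_le (M a b : ℝ) :
    ∫ t in a..b, M * (1 + (M * t) ^ 2)⁻¹ ≤ π := by
  rw [intervalIntegral.integral_const_mul, intervalIntegral.mul_integral_comp_mul_left
    (f := fun u => (1 + u ^ 2)⁻¹), integral_inv_one_add_sq]
  linarith [Real.arctan_lt_pi_div_two (M * b), Real.neg_pi_div_two_lt_arctan (M * a)]

lemma ConvexTail.integral_abs_cosKernel_sub_mainTerm_le {ψ : ℕ → ℝ} {n : ℕ} {M : ℝ}
    (h : ConvexTail ψ n M) (θ : ℝ) :
    ∫ t in (-π)..π, |cosKernel ψ θ n t - ψ n * mainTerm n θ M⁻¹ t| ≤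
      ψ n * (2 * π ^ 2 + π ^ 3) := by
  have hψn : 0 ≤ ψ n := h.nonneg 0
  have hle : -π ≤ π := by linarith [Real.pi_pos]
  have hcont : Continuous fun t : ℝ => M * (1 + (M * t) ^ 2)⁻¹ :=
    continuous_const.mul ((by fun_prop : Continuous fun t : ℝ => 1 + (M * t) ^ 2).inv₀
      fun t => by positivity)
  have hmajorant : Continuous fun t : ℝ => ψ n * (π + π ^ 2 * (M * (1 + (M * t) ^ 2)⁻¹)) :=
    (continuous_const.add (hcont.const_mul _)).const_mul _
  calc ∫ t in (-π)..π, |cosKernel ψ θ n t - ψ n * mainTerm n θ M⁻¹ t|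
      ≤ ∫ t in (-π)..π, ψ n * (π + π ^ 2 * (M * (1 + (M * t) ^ 2)⁻¹)) := by
        refine (Real.le_norm_self _).trans (intervalIntegral.norm_integral_le_of_norm_le hle
          (ae_of_all _ fun t ht => ?_) (hmajorant.intervalIntegrable _ _))
        rw [Real.norm_eq_abs, abs_abs, ← mul_assoc (π ^ 2)]
        exact h.abs_cosKernel_sub_mainTerm_le θ (abs_le.2 ⟨ht.1.le, ht.2⟩)
    _ = ψ n * (2 * π ^ 2 + π ^ 2 * ∫ t in (-π)..π, M * (1 + (M * t) ^ 2)⁻¹) := by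
        rw [intervalIntegral.integral_const_mul, intervalIntegral.integral_add (by simp)
          ((hcont.const_mul _).intervalIntegrable _ _), intervalIntegral.integral_const,
          intervalIntegral.integral_const_mul]
        simp only [smul_eq_mul]
        ring
    _ ≤ ψ n * (2 * π ^ 2 + π ^ 2 * π) := by
        gcongr
        exact integral_mul_inv_one_add_sq_le M _ _
    _ = ψ n * (2 * π ^ 2 + π ^ 3) := by ring

section Oscillation

lemma abs_intervalIntegral_le_of_periodic {g : ℝ → ℝ} {T C : ℝ} (hT : 0 < T)
    (hg : Function.Periodic g T) (hint : ∀ a b, IntervalIntegrable g volume a b)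
    (hC : ∀ x, |g x| ≤ C) (h0 : ∫ x in (0)..T, g x = 0) (a b : ℝ) :
    |∫ x in a..b, g x| ≤ C * T := by
  set c := a + ⌊(b - a) / T⌋ • T with hc
  have hperiods : ∫ x in a..c, g x = 0 := by
    rw [hg.intervalIntegral_add_zsmul_eq _ a hint, hg.intervalIntegral_add_eq a 0, zero_add, h0,
      smul_zero]
  have hrest : |b - c| ≤ T := by
    have hfloor := (le_div_iff₀ hT).1 (Int.floor_le ((b - a) / T))
    have hceil := (div_lt_iff₀ hT).1 (Int.lt_floor_add_one ((b - a) / T))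
    rw [hc, zsmul_eq_mul, abs_le]
    constructor <;> linarith
  calc |∫ x in a..b, g x| = ‖∫ x in c..b, g x‖ := by
        rw [← intervalIntegral.integral_add_adjacent_intervals (hint a c) (hint c b), hperiods,
          zero_add, Real.norm_eq_abs]
    _ ≤ C * |b - c| := intervalIntegral.norm_integral_le_of_norm_le_const fun x _ => hC x
    _ ≤ C * T := mul_le_mul_of_nonneg_left hrest ((abs_nonneg _).trans (hC 0))

lemma abs_intervalIntegral_comp_mul_sub_le_of_periodic {g : ℝ → ℝ} {T C N : ℝ} (hT : 0 < T)
    (hg : Function.Periodic g T) (hint : ∀ a b, IntervalIntegrable g volume a b)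
    (hC : ∀ x, |g x| ≤ C) (h0 : ∫ x in (0)..T, g x = 0) (hN : 0 < N) (θ a b : ℝ) :
    |∫ x in a..b, g (N * x - θ)| ≤ C * T / N := by
  rw [intervalIntegral.integral_comp_mul_sub g hN.ne' θ, smul_eq_mul, abs_mul,
    abs_of_pos (inv_pos.2 hN), ← div_eq_inv_mul]
  gcongr
  exact abs_intervalIntegral_le_of_periodic hT hg hint hC h0 _ _

lemma intervalIntegrable_div_of_pos {g : ℝ → ℝ} (hg : Continuous g) {a b : ℝ} (ha : 0 < a)
    (hab : a ≤ b) : IntervalIntegrable (fun t => g t / t) volume a b := by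
  refine ContinuousOn.intervalIntegrable (hg.continuousOn.div continuousOn_id fun t ht => ?_)
  rw [Set.uIcc_of_le hab] at ht
  exact (ha.trans_le ht.1).ne'

lemma integral_div_eq_add_integral {g : ℝ → ℝ} (hg : Continuous g) {a b : ℝ} (ha : 0 < a)
    (hab : a ≤ b) : ∫ t in a..b, g t / t =
      b⁻¹ * (∫ t in a..b, g t) + ∫ x in a..b, (x ^ 2)⁻¹ * ∫ t in a..x, g t := by
  have hne : ∀ x ∈ Set.uIcc a b, x ≠ 0 := fun x hx => by
    rw [Set.uIcc_of_le hab] at hx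
    exact (ha.trans_le hx.1).ne'
  have hparts := intervalIntegral.integral_mul_deriv_eq_deriv_mul (a := a) (b := b)
    (u := fun t : ℝ => t⁻¹) (v := fun x => ∫ t in a..x, g t) (v' := g)
    (fun x hx => hasDerivAt_inv (hne x hx))
    (fun x _ => (hg.integral_hasStrictDerivAt a x).hasDerivAt)
    (ContinuousOn.intervalIntegrable
      ((continuousOn_pow 2).inv₀ fun x hx => pow_ne_zero 2 (hne x hx)).neg)
    (hg.intervalIntegrable _ _)
  simp only [intervalIntegral.integral_same, mul_zero, sub_zero, neg_mul,
    intervalIntegral.integral_neg, sub_neg_eq_add] at hparts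
  simpa only [div_eq_inv_mul] using hparts

lemma abs_integral_div_le {g : ℝ → ℝ} (hg : Continuous g) {a b B : ℝ} (ha : 0 < a) (hab : a ≤ b)
    (hB : ∀ x, |∫ t in a..x, g t| ≤ B) : |∫ t in a..b, g t / t| ≤ B / a := by
  have hb : 0 < b := ha.trans_le hab
  have hmem : (0 : ℝ) ∉ Set.uIcc a b := Set.notMem_uIcc_of_lt ha hb
  have hsq : IntervalIntegrable (fun x : ℝ => (x ^ 2)⁻¹) volume a b := by
    simpa using intervalIntegral.intervalIntegrable_zpow (n := -2) (.inr hmem)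
  have hintsq : ∫ x in a..b, (x ^ 2)⁻¹ = a⁻¹ - b⁻¹ := by
    have h := integral_zpow (n := -2) (.inr ⟨by norm_num, hmem⟩)
    norm_num at h
    linarith
  have hend : |b⁻¹ * ∫ t in a..b, g t| ≤ b⁻¹ * B := by
    rw [abs_mul, abs_of_pos (inv_pos.2 hb)]
    gcongr
    exact hB b
  have hbulk : |∫ x in a..b, (x ^ 2)⁻¹ * ∫ t in a..x, g t| ≤ (a⁻¹ - b⁻¹) * B := by
    rw [← hintsq, ← intervalIntegral.integral_mul_const, ← Real.norm_eq_abs]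
    refine intervalIntegral.norm_integral_le_of_norm_le hab (ae_of_all _ fun x _ => ?_)
      (hsq.mul_const B)
    rw [norm_mul, Real.norm_of_nonneg (by positivity)]
    gcongr
    exact hB x
  rw [integral_div_eq_add_integral hg ha hab]
  calc _ ≤ b⁻¹ * B + (a⁻¹ - b⁻¹) * B := (abs_add_le _ _).trans (add_le_add hend hbulk)
    _ = B / a := by ring

lemma integral_abs_sin_sub_two_div_pi : ∫ u in (0)..π, (|Real.sin u| - 2 / π) = 0 := by
  have habs : ∫ u in (0)..π, |Real.sin u| = ∫ u in (0)..π, Real.sin u :=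
    intervalIntegral.integral_congr fun u hu => by
      rw [Set.uIcc_of_le Real.pi_pos.le] at hu
      exact abs_of_nonneg (Real.sin_nonneg_of_mem_Icc hu)
  rw [intervalIntegral.integral_sub (Continuous.intervalIntegrable (by fun_prop) _ _) (by simp),
    habs, integral_sin, intervalIntegral.integral_const, Real.cos_zero, Real.cos_pi, smul_eq_mul]
  field_simp
  ring

lemma abs_integral_abs_sin_div_sub_le {N a b : ℝ} (hN : 0 < N) (θ : ℝ) (ha : 0 < a)
    (hab : a ≤ b) :
    |(∫ t in a..b, |Real.sin (N * t - θ)| / t) - 2 / π * Real.log (b / a)| ≤ π / N / a := by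
  have hper : Function.Periodic (fun u : ℝ => |Real.sin u| - 2 / π) π := fun u => by
    simp [Real.sin_add_pi]
  have hbound : ∀ u : ℝ, |(|Real.sin u| - 2 / π)| ≤ 1 := fun u => by
    have hle : 2 / π ≤ 1 := (div_le_one Real.pi_pos).2 Real.two_le_pi
    have hpos : 0 < 2 / π := by positivity
    rw [abs_le]
    constructor <;> linarith [Real.abs_sin_le_one u, abs_nonneg (Real.sin u)]
  have hmean : ∀ x, |∫ t in a..x, (|Real.sin (N * t - θ)| - 2 / π)| ≤ π / N := fun x => by
    simpa only [one_mul] using abs_intervalIntegral_comp_mul_sub_le_of_periodic Real.pi_pos hper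
      (fun a b => Continuous.intervalIntegrable (by fun_prop) a b) hbound
      integral_abs_sin_sub_two_div_pi hN θ a x
  have hsplit : ∫ t in a..b, (|Real.sin (N * t - θ)| - 2 / π) / t =
      (∫ t in a..b, |Real.sin (N * t - θ)| / t) - 2 / π * Real.log (b / a) := by
    simp only [sub_div]
    rw [intervalIntegral.integral_sub (intervalIntegrable_div_of_pos (by fun_prop) ha hab)
      (intervalIntegrable_div_of_pos continuous_const ha hab),
      ← integral_one_div_of_pos ha (ha.trans_le hab), ← intervalIntegral.integral_const_mul]
    simp only [mul_one_div]
  rw [← hsplit]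
  exact abs_integral_div_le (by fun_prop) ha hab hmean

end Oscillation

section MainTerm

variable {n : ℕ} {δ : ℝ}

lemma abs_mainTerm_neg (n : ℕ) (θ δ t : ℝ) :
    |mainTerm n θ δ (-t)| = |mainTerm n (-θ) δ t| := by
  have hsin : Real.sin (n * -t - θ) = -Real.sin (n * t - -θ) := by
    rw [← Real.sin_neg]
    ring_nf
  unfold mainTerm
  rw [abs_neg t, hsin, neg_div_neg_eq]

lemma integral_abs_mainTerm_zero_pi (n : ℕ) (θ : ℝ) (hδ : 0 < δ) (hδπ : δ ≤ π) :
    ∫ t in (0)..π, |mainTerm n θ δ t| = ∫ t in δ..π, |Real.sin (n * t - θ)| / t := by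
  have hnear : ∫ t in (0)..δ, |mainTerm n θ δ t| = 0 := by
    rw [intervalIntegral.integral_congr_Ioo_of_le (g := fun _ => 0) hδ.le fun t ht => ?_]
    · simp
    · dsimp only
      rw [mainTerm, abs_of_pos ht.1, if_neg (not_le.2 ht.2), abs_zero]
  rw [← intervalIntegral.integral_add_adjacent_intervals
      (intervalIntegrable_mainTerm n θ hδ 0 δ).abs (intervalIntegrable_mainTerm n θ hδ δ π).abs,
    hnear, zero_add]
  refine intervalIntegral.integral_congr_Ioo_of_le hδπ fun t ht => ?_
  have ht0 : 0 < t := hδ.trans ht.1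
  rw [mainTerm, abs_of_pos ht0, if_pos ht.1.le, abs_neg, abs_div, abs_of_pos ht0]

lemma abs_integral_abs_mainTerm_sub_le (hn : n ≠ 0) (θ : ℝ) (hδ : 0 < δ) (hδπ : δ ≤ π) :
    |(∫ t in (-π)..π, |mainTerm n θ δ t|) - 4 / π * Real.log (π / δ)| ≤ 2 * π / n / δ := by
  have hint := fun a b => (intervalIntegrable_mainTerm n θ hδ a b).abs
  have hn0 : (0 : ℝ) < n := Nat.cast_pos.2 hn.bot_lt
  have hreflect : ∫ t in (-π)..0, |mainTerm n θ δ t| = ∫ t in (0)..π, |mainTerm n (-θ) δ t| := by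
    have h := intervalIntegral.integral_comp_neg (a := 0) (b := π) fun t => |mainTerm n θ δ t|
    rw [neg_zero] at h
    simp only [← h, abs_mainTerm_neg]
  rw [← intervalIntegral.integral_add_adjacent_intervals (hint (-π) 0) (hint 0 π), hreflect,
    integral_abs_mainTerm_zero_pi n _ hδ hδπ, integral_abs_mainTerm_zero_pi n _ hδ hδπ]
  have hleft := abs_integral_abs_sin_div_sub_le hn0 (-θ) hδ hδπ
  have hright := abs_integral_abs_sin_div_sub_le hn0 θ hδ hδπ
  calc _ = |((∫ t in δ..π, |Real.sin (n * t - -θ)| / t) - 2 / π * Real.log (π / δ)) +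
          ((∫ t in δ..π, |Real.sin (n * t - θ)| / t) - 2 / π * Real.log (π / δ))| := by ring_nf
    _ ≤ π / n / δ + π / n / δ := (abs_add_le _ _).trans (add_le_add hleft hright)
    _ = 2 * π / n / δ := by ring

end MainTerm

section SinSign

/-- The sign of the sine function, used to build extremal functions for the approximation. By the
convention `0 / 0 = 0` it vanishes at the zeros of the sine. -/
noncomputable def sinSign (u : ℝ) : ℝ := Real.sin u / |Real.sin u|

lemma measurable_sinSign : Measurable sinSign := by
  unfold sinSign
  fun_prop

lemma abs_sinSign_le (u : ℝ) : |sinSign u| ≤ 1 := by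
  rw [sinSign, abs_div, abs_abs]
  exact div_self_le_one _

lemma sinSign_mul_sin (u : ℝ) : sinSign u * Real.sin u = |Real.sin u| := by
  rw [sinSign, div_mul_eq_mul_div, ← abs_mul_abs_self, mul_self_div_self]

lemma sinSign_add_pi (u : ℝ) : sinSign (u + π) = -sinSign u := by
  simp only [sinSign, Real.sin_add_pi, abs_neg, neg_div]

lemma sinSign_of_pos_of_lt_pi {u : ℝ} (h0 : 0 < u) (hπ : u < π) : sinSign u = 1 := by
  have hsin := Real.sin_pos_of_pos_of_lt_pi h0 hπ
  rw [sinSign, abs_of_pos hsin, div_self hsin.ne']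

lemma sinSign_of_neg_of_neg_pi_lt {u : ℝ} (h0 : u < 0) (hπ : -π < u) : sinSign u = -1 := by
  have hsin := Real.sin_neg_of_neg_of_neg_pi_lt h0 hπ
  rw [sinSign, abs_of_neg hsin, div_neg, div_self hsin.ne]

lemma sinSign_periodic : Function.Periodic sinSign (2 * π) := fun u => by
  rw [two_mul, ← add_assoc, sinSign_add_pi, sinSign_add_pi, neg_neg]

lemma abs_integral_sinSign_mul_sub_le {N : ℝ} (hN : 0 < N) (θ a b : ℝ) :
    |∫ t in a..b, sinSign (N * t - θ)| ≤ 2 * π / N := by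
  have hint := intervalIntegrable_of_abs_le measurable_sinSign abs_sinSign_le
  have hmean : ∫ u in (0)..(2 * π), sinSign u = 0 := by
    have hshift := intervalIntegral.integral_comp_add_right (a := 0) (b := π) sinSign π
    rw [zero_add, ← two_mul] at hshift
    rw [← intervalIntegral.integral_add_adjacent_intervals (hint 0 π) (hint π (2 * π)), ← hshift]
    simp only [sinSign_add_pi, intervalIntegral.integral_neg, add_neg_cancel]
  simpa only [one_mul] using abs_intervalIntegral_comp_mul_sub_le_of_periodic Real.two_pi_pos
    sinSign_periodic hint abs_sinSign_le hmean hN θ a b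

end SinSign

section SignTest

/-- The sign of `mainTerm n θ δ` on a period, extended periodically and without the cut-off at the
origin. -/
noncomputable def signTest (n : ℕ) (θ t : ℝ) : ℝ :=
  -(sinSign t * sinSign (n * t - θ))

lemma measurable_signTest (n : ℕ) (θ : ℝ) : Measurable (signTest n θ) :=
  (measurable_sinSign.mul (measurable_sinSign.comp (by fun_prop))).neg

lemma abs_signTest_le (n : ℕ) (θ t : ℝ) : |signTest n θ t| ≤ 1 := by
  rw [signTest, abs_neg, abs_mul]
  exact mul_le_one₀ (abs_sinSign_le _) (abs_nonneg _) (abs_sinSign_le _)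

lemma signTest_periodic (n : ℕ) (θ : ℝ) : Function.Periodic (signTest n θ) (2 * π) := fun t => by
  have hshift : (n : ℝ) * (t + 2 * π) - θ = n * t - θ + n * (2 * π) := by ring
  rw [signTest, hshift, sinSign_periodic, sinSign_periodic.nat_mul, signTest]

lemma intervalIntegrable_signTest (n : ℕ) (θ a b : ℝ) :
    IntervalIntegrable (signTest n θ) volume a b :=
  intervalIntegrable_of_abs_le (measurable_signTest n θ) (abs_signTest_le n θ) a b

lemma mainTerm_mul_signTest (n : ℕ) (θ δ : ℝ) {t : ℝ} (ht : t ∈ Set.Ioo (-π) π) :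
    mainTerm n θ δ t * signTest n θ t = |mainTerm n θ δ t| := by
  have hsign : sinSign t / t = |t|⁻¹ := by
    rcases lt_trichotomy t 0 with hneg | rfl | hpos
    · rw [sinSign_of_neg_of_neg_pi_lt hneg ht.1, abs_of_neg hneg, inv_neg, neg_div, one_div]
    · rw [div_zero, abs_zero, inv_zero]
    · rw [sinSign_of_pos_of_lt_pi hpos ht.2, abs_of_pos hpos, one_div]
  unfold mainTerm signTest
  split_ifs
  · rw [abs_neg, abs_div, ← sinSign_mul_sin, div_eq_mul_inv _ |t|, ← hsign]
    ring
  · rw [zero_mul, abs_zero]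

lemma abs_integral_signTest_le {n : ℕ} (hn : n ≠ 0) (θ : ℝ) :
    |∫ t in (-π)..π, signTest n θ t| ≤ 4 * π / n := by
  have hn0 : (0 : ℝ) < n := Nat.cast_pos.2 hn.bot_lt
  have hπ := Real.pi_pos
  have hleft : ∫ t in (-π)..0, signTest n θ t = ∫ t in (-π)..0, sinSign (n * t - θ) :=
    intervalIntegral.integral_congr_Ioo_of_le (by linarith) fun t ht => by
      rw [signTest, sinSign_of_neg_of_neg_pi_lt ht.2 ht.1, neg_one_mul, neg_neg]
  have hright : ∫ t in (0)..π, signTest n θ t = -∫ t in (0)..π, sinSign (n * t - θ) := by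
    rw [← intervalIntegral.integral_neg]
    exact intervalIntegral.integral_congr_Ioo_of_le hπ.le fun t ht => by
      rw [signTest, sinSign_of_pos_of_lt_pi ht.1 ht.2, one_mul]
  rw [← intervalIntegral.integral_add_adjacent_intervals (intervalIntegrable_signTest n θ (-π) 0)
    (intervalIntegrable_signTest n θ 0 π), hleft, hright, ← sub_eq_add_neg]
  calc _ ≤ 2 * π / n + 2 * π / n := (abs_sub _ _).trans (add_le_add
          (abs_integral_sinSign_mul_sub_le hn0 θ _ _) (abs_integral_sinSign_mul_sub_le hn0 θ _ _))
    _ = 4 * π / n := by ring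

end SignTest

lemma sub_const_mem_zeroMeanBall_top {φ : ℝ → ℝ} (hper : Function.Periodic φ (2 * π))
    (hmeas : Measurable φ) (hφ : ∀ t, |φ t| ≤ 1) {μ : ℝ}
    (hμ : ∫ t in (-π)..π, φ t = 2 * π * μ) (hμ1 : |μ| ≤ 1) :
    (fun t => (1 - |μ|) * (φ t - μ)) ∈ zeroMeanBall ⊤ := by
  have hbound (t : ℝ) : |(1 - |μ|) * (φ t - μ)| ≤ 1 := calc
    |(1 - |μ|) * (φ t - μ)| = (1 - |μ|) * |φ t - μ| := by
        rw [abs_mul, abs_of_nonneg (sub_nonneg.2 hμ1)]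
    _ ≤ (1 - |μ|) * (1 + |μ|) :=
        mul_le_mul_of_nonneg_left ((abs_sub _ _).trans (add_le_add_left (hφ t) _))
          (sub_nonneg.2 hμ1)
    _ ≤ 1 := by nlinarith [sq_nonneg |μ|]
  refine ⟨fun t => by simp only [hper t], by fun_prop, ?_, ?_⟩
  · rw [eLpNorm_exponent_top, ← ENNReal.ofReal_one]
    exact eLpNormEssSup_le_of_ae_bound (ae_of_all _ hbound)
  · rw [intervalIntegral.integral_const_mul, intervalIntegral.integral_sub
      (intervalIntegrable_of_abs_le hmeas hφ _ _) intervalIntegrable_const, hμ,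
      intervalIntegral.integral_const, smul_eq_mul]
    ring

lemma two_mul_pi_sq_add_pi_pow_three_add_pi_le : 2 * π ^ 2 + π ^ 3 + π ≤ 54 := by
  have hπ : π ≤ 3.1416 := Real.pi_lt_d4.le
  calc 2 * π ^ 2 + π ^ 3 + π ≤ 2 * 3.1416 ^ 2 + 3.1416 ^ 3 + 3.1416 := by gcongr
    _ ≤ 54 := by norm_num

lemma integral_cosKernel_mul_const_mul_sub {ψ : ℕ → ℝ} (hψ : Summable ψ) (θ : ℝ) {n : ℕ}
    (hn : n ≠ 0) {φ : ℝ → ℝ} (hφ : IntervalIntegrable φ volume (-π) π) (c μ : ℝ) :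
    ∫ t in (-π)..π, cosKernel ψ θ n t * (c * (φ t - μ)) =
      c * ∫ t in (-π)..π, cosKernel ψ θ n t * φ t := by
  have hK := continuous_cosKernel hψ θ n
  simp only [mul_left_comm (cosKernel ψ θ n _) c, mul_sub (cosKernel ψ θ n _)]
  rw [intervalIntegral.integral_const_mul, intervalIntegral.integral_sub
    (hφ.continuousOn_mul hK.continuousOn) ((hK.intervalIntegrable _ _).mul_const μ),
    intervalIntegral.integral_mul_const, integral_cosKernel hψ θ hn, zero_mul, sub_zero]

namespace ConvexTail

variable {ψ : ℕ → ℝ} {n : ℕ} {M : ℝ}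

lemma ne_zero (h : ConvexTail ψ n M) : n ≠ 0 := by
  rintro rfl
  linarith [h.one_le, Nat.cast_zero (R := ℝ) ▸ h.two_mul_le]

lemma abs_integral_abs_mainTerm_sub_le (h : ConvexTail ψ n M) (θ : ℝ) :
    |(∫ t in (-π)..π, |mainTerm n θ M⁻¹ t|) - 4 / π * Real.log (π * M)| ≤ π := by
  have hM : 0 < M := zero_lt_one.trans_le h.one_le
  have hn0 : (0 : ℝ) < n := Nat.cast_pos.2 h.ne_zero.bot_lt
  have hcut : M⁻¹ ≤ π := (inv_le_one_of_one_le₀ h.one_le).trans (by linarith [Real.pi_gt_three])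
  have hmain := FourierApprox.abs_integral_abs_mainTerm_sub_le h.ne_zero θ (inv_pos.2 hM) hcut
  rw [div_inv_eq_mul, div_inv_eq_mul] at hmain
  refine hmain.trans ?_
  rw [div_mul_eq_mul_div, div_le_iff₀ hn0]
  nlinarith [h.two_mul_le, Real.pi_pos]

lemma intervalIntegrable_cosKernel_sub_mainTerm (h : ConvexTail ψ n M) (θ a b : ℝ) :
    IntervalIntegrable (fun t => cosKernel ψ θ n t - ψ n * mainTerm n θ M⁻¹ t) volume a b :=
  ((continuous_cosKernel h.summable θ n).intervalIntegrable a b).sub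
    ((intervalIntegrable_mainTerm n θ (inv_pos.2 (zero_lt_one.trans_le h.one_le)) a b).const_mul _)

lemma integral_abs_cosKernel_le (h : ConvexTail ψ n M) (θ : ℝ) :
    ∫ t in (-π)..π, |cosKernel ψ θ n t| ≤ ψ n * (4 / π * Real.log (π * M) + 54) := by
  have hψn : 0 ≤ ψ n := h.nonneg 0
  have herror := h.intervalIntegrable_cosKernel_sub_mainTerm θ (-π) π |>.abs
  have hmain := (intervalIntegrable_mainTerm n θ
    (inv_pos.2 (zero_lt_one.trans_le h.one_le)) (-π) π).abs.const_mul (ψ n)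
  calc ∫ t in (-π)..π, |cosKernel ψ θ n t|
      ≤ ∫ t in (-π)..π, (|cosKernel ψ θ n t - ψ n * mainTerm n θ M⁻¹ t| +
          ψ n * |mainTerm n θ M⁻¹ t|) := by
        refine intervalIntegral.integral_mono (by linarith [Real.pi_pos])
          ((continuous_cosKernel h.summable θ n).abs.intervalIntegrable _ _)
          (herror.add hmain) fun t => ?_
        dsimp only
        rw [← abs_of_nonneg hψn, ← abs_mul, abs_of_nonneg hψn]
        simpa using abs_add_le (cosKernel ψ θ n t - ψ n * mainTerm n θ M⁻¹ t)
          (ψ n * mainTerm n θ M⁻¹ t)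
    _ ≤ ψ n * (2 * π ^ 2 + π ^ 3) + ψ n * (4 / π * Real.log (π * M) + π) := by
        rw [intervalIntegral.integral_add herror hmain, intervalIntegral.integral_const_mul]
        gcongr
        · exact h.integral_abs_cosKernel_sub_mainTerm_le θ
        · linarith [(abs_le.1 (h.abs_integral_abs_mainTerm_sub_le θ)).2]
    _ ≤ ψ n * (4 / π * Real.log (π * M) + 54) := by
        rw [← mul_add]
        refine mul_le_mul_of_nonneg_left ?_ hψn
        linarith [two_mul_pi_sq_add_pi_pow_three_add_pi_le]

lemma le_integral_cosKernel_mul_signTest (h : ConvexTail ψ n M) (θ : ℝ) :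
    ψ n * (4 / π * Real.log (π * M) - 54) ≤
      ∫ t in (-π)..π, cosKernel ψ θ n t * signTest n θ t := by
  have hψn : 0 ≤ ψ n := h.nonneg 0
  have herror := h.intervalIntegrable_cosKernel_sub_mainTerm θ (-π) π |>.abs
  have hmain := (intervalIntegrable_mainTerm n θ
    (inv_pos.2 (zero_lt_one.trans_le h.one_le)) (-π) π).abs.const_mul (ψ n)
  calc ψ n * (4 / π * Real.log (π * M) - 54)
      ≤ ψ n * (4 / π * Real.log (π * M) - π) - ψ n * (2 * π ^ 2 + π ^ 3) := by
        rw [← mul_sub]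
        refine mul_le_mul_of_nonneg_left ?_ hψn
        linarith [two_mul_pi_sq_add_pi_pow_three_add_pi_le]
    _ ≤ ∫ t in (-π)..π, (ψ n * |mainTerm n θ M⁻¹ t| -
          |cosKernel ψ θ n t - ψ n * mainTerm n θ M⁻¹ t|) := by
        rw [intervalIntegral.integral_sub hmain herror, intervalIntegral.integral_const_mul]
        refine sub_le_sub (mul_le_mul_of_nonneg_left ?_ hψn)
          (h.integral_abs_cosKernel_sub_mainTerm_le θ)
        linarith [(abs_le.1 (h.abs_integral_abs_mainTerm_sub_le θ)).1]
    _ ≤ ∫ t in (-π)..π, cosKernel ψ θ n t * signTest n θ t := by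
        refine intervalIntegral.integral_mono_on_of_le_Ioo (by linarith [Real.pi_pos])
          (hmain.sub herror) ((intervalIntegrable_signTest n θ _ _).continuousOn_mul
            (continuous_cosKernel h.summable θ n).continuousOn) fun t ht => ?_
        rw [← mainTerm_mul_signTest n θ M⁻¹ ht]
        have hdual : |(cosKernel ψ θ n t - ψ n * mainTerm n θ M⁻¹ t) * signTest n θ t| ≤
            |cosKernel ψ θ n t - ψ n * mainTerm n θ M⁻¹ t| := by
          rw [abs_mul]
          exact mul_le_of_le_one_right (abs_nonneg _) (abs_signTest_le n θ t)
        linarith [(abs_le.1 hdual).1]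

-- The mean of `signTest` is `O(1 / n)`; subtracting it does not change the integral against the
-- kernel, and rescaling to the unit ball costs only `O(log (π M) / n) = O(1)`.
lemma exists_mem_zeroMeanBall_le_integral (h : ConvexTail ψ n M) (θ : ℝ) :
    ∃ φ ∈ zeroMeanBall ⊤, ψ n * (4 / π * Real.log (π * M) - 58) ≤
      ∫ t in (-π)..π, cosKernel ψ θ n t * φ t := by
  have hM : 0 < M := zero_lt_one.trans_le h.one_le
  have hn0 : (0 : ℝ) < n := Nat.cast_pos.2 h.ne_zero.bot_lt
  have hψn : 0 ≤ ψ n := h.nonneg 0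
  set μ := (∫ t in (-π)..π, signTest n θ t) / (2 * π) with hμ
  have hμn : |μ| ≤ 2 / n := by
    rw [hμ, abs_div, abs_of_pos Real.two_pi_pos, div_le_iff₀ Real.two_pi_pos]
    exact (abs_integral_signTest_le h.ne_zero θ).trans_eq (by ring)
  have hμ1 : |μ| ≤ 1 :=
    hμn.trans ((div_le_one hn0).2 (by linarith [h.one_le, h.two_mul_le]))
  have hloss : |μ| * (4 / π * Real.log (π * M)) ≤ 4 := calc
    |μ| * (4 / π * Real.log (π * M)) ≤ 2 / n * (4 / π * (π * M)) := by
        have hlog := Real.log_le_self (by positivity : 0 ≤ π * M)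
        have hlog0 : 0 ≤ Real.log (π * M) :=
          Real.log_nonneg (by nlinarith [Real.pi_gt_three, h.one_le])
        gcongr
    _ = 4 * (2 * M) / n := by field_simp
    _ ≤ 4 := (div_le_iff₀ hn0).2 (by linarith [h.two_mul_le])
  refine ⟨_, sub_const_mem_zeroMeanBall_top (signTest_periodic n θ) (measurable_signTest n θ)
    (abs_signTest_le n θ) (mul_div_cancel₀ _ Real.two_pi_pos.ne').symm hμ1, ?_⟩
  rw [integral_cosKernel_mul_const_mul_sub h.summable θ h.ne_zero
    (intervalIntegrable_signTest n θ _ _)]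
  calc ψ n * (4 / π * Real.log (π * M) - 58)
      ≤ (1 - |μ|) * (ψ n * (4 / π * Real.log (π * M) - 54)) := by
        nlinarith [mul_le_mul_of_nonneg_left hloss hψn, mul_nonneg hψn (abs_nonneg μ)]
    _ ≤ _ := mul_le_mul_of_nonneg_left (h.le_integral_cosKernel_mul_signTest θ)
        (sub_nonneg.2 hμ1)

end ConvexTail

lemma integral_cos_sub_mul_cos_sub {k m : ℕ} (hkm : k + m ≠ 0) (a b : ℝ) :
    ∫ t in (-π)..π, Real.cos (k * t - a) * Real.cos (m * t - b) =
      if k = m then π * Real.cos (a - b) else 0 := by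
  have hint (j : ℤ) (c : ℝ) : IntervalIntegrable (fun t => Real.cos (j * t - c)) volume (-π) π :=
    (by fun_prop : Continuous fun t => Real.cos (j * t - c)).intervalIntegrable _ _
  have hprod (t : ℝ) : Real.cos (k * t - a) * Real.cos (m * t - b) =
      (Real.cos ((k - m : ℤ) * t - (a - b)) + Real.cos ((k + m : ℤ) * t - (a + b))) / 2 := by
    have h₁ : ((k - m : ℤ) : ℝ) * t - (a - b) = (k * t - a) - (m * t - b) := by push_cast; ring
    have h₂ : ((k + m : ℤ) : ℝ) * t - (a + b) = (k * t - a) + (m * t - b) := by push_cast; ring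
    rw [h₁, h₂, ← Real.two_mul_cos_mul_cos]
    ring
  simp_rw [hprod]
  rw [intervalIntegral.integral_div, intervalIntegral.integral_add (hint _ _) (hint _ _),
    integral_cos_intCast_mul_sub (j := k + m) (by omega), add_zero]
  split_ifs with h
  · simp only [h, sub_self, Int.cast_zero, zero_mul, zero_sub, Real.cos_neg,
      intervalIntegral.integral_const, smul_eq_mul]
    ring
  · rw [integral_cos_intCast_mul_sub (by omega), zero_div]

/-- The term of frequency `k` of the trigonometric series with cosine coefficients `p` and sine
coefficients `q`. -/
noncomputable def trigTerm (p q : ℕ → ℝ) (k : ℕ) (x : ℝ) : ℝ :=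
  p k * Real.cos (k * x) + q k * Real.sin (k * x)

section TrigSeries

variable {p q : ℕ → ℝ}

lemma continuous_trigTerm (p q : ℕ → ℝ) (k : ℕ) : Continuous (trigTerm p q k) := by
  unfold trigTerm
  fun_prop

lemma abs_trigTerm_le (p q : ℕ → ℝ) (k : ℕ) (x : ℝ) : |trigTerm p q k x| ≤ |p k| + |q k| := by
  refine (abs_add_le _ _).trans ?_
  rw [abs_mul, abs_mul]
  exact add_le_add (mul_le_of_le_one_right (abs_nonneg _) (Real.abs_cos_le_one _))
    (mul_le_of_le_one_right (abs_nonneg _) (Real.abs_sin_le_one _))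

lemma integral_trigTerm_mul_cos_sub (p q : ℕ → ℝ) {k m : ℕ} (hkm : k + m ≠ 0) (b : ℝ) :
    ∫ t in (-π)..π, trigTerm p q k t * Real.cos (m * t - b) =
      if k = m then π * (p m * Real.cos b + q m * Real.sin b) else 0 := by
  have hint (c a : ℝ) : IntervalIntegrable
      (fun t => c * (Real.cos (k * t - a) * Real.cos (m * t - b))) volume (-π) π :=
    Continuous.intervalIntegrable (by fun_prop) _ _
  have hphase (t : ℝ) : trigTerm p q k t * Real.cos (m * t - b) =
      p k * (Real.cos (k * t - 0) * Real.cos (m * t - b)) +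
        q k * (Real.cos (k * t - π / 2) * Real.cos (m * t - b)) := by
    rw [sub_zero, Real.cos_sub_pi_div_two, trigTerm]
    ring
  simp_rw [hphase]
  rw [intervalIntegral.integral_add (hint _ _) (hint _ _), intervalIntegral.integral_const_mul,
    intervalIntegral.integral_const_mul, integral_cos_sub_mul_cos_sub hkm,
    integral_cos_sub_mul_cos_sub hkm]
  split_ifs with h
  · rw [zero_sub, Real.cos_neg, Real.cos_pi_div_two_sub, h]
    ring
  · ring

lemma summable_abs_add_abs_tail (hp : Summable p) (hq : Summable q) (n : ℕ) :
    Summable fun j => |p (n + j)| + |q (n + j)| :=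
  (summable_tail hp n).abs.add (summable_tail hq n).abs

lemma continuous_tsum_trigTerm (hp : Summable p) (hq : Summable q) (n : ℕ) :
    Continuous fun x => ∑' j, trigTerm p q (n + j) x :=
  continuous_tsum (fun _ => continuous_trigTerm p q _) (summable_abs_add_abs_tail hp hq n)
    fun _ _ => abs_trigTerm_le p q _ _

lemma integral_tsum_trigTerm_mul_cos_sub (hp : Summable p) (hq : Summable q) (m : ℕ) (b : ℝ) :
    ∫ t in (-π)..π, (∑' j, trigTerm p q (1 + j) t) * Real.cos (m * t - b) =
      if m = 0 then 0 else π * (p m * Real.cos b + q m * Real.sin b) := by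
  rw [← (hasSum_integral_tsum_mul (summable_abs_add_abs_tail hp hq 1)
    (fun _ => continuous_trigTerm p q _) (fun _ _ => abs_trigTerm_le p q _ _)
    (Continuous.intervalIntegrable (by fun_prop) _ _)).tsum_eq]
  have hterm (j : ℕ) := integral_trigTerm_mul_cos_sub p q (show 1 + j + m ≠ 0 by omega) b
  simp_rw [hterm]
  rcases m with _ | m
  · simp
  · simp [add_comm 1]

variable {a : ℝ} {f : ℝ → ℝ}

lemma integral_trigSeries_mul_cos_sub (hp : Summable p) (hq : Summable q)
    (hf : ∀ x, f x = a + ∑' j, trigTerm p q (1 + j) x) (m : ℕ) (b : ℝ) :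
    ∫ t in (-π)..π, f t * Real.cos (m * t - b) =
      if m = 0 then 2 * π * (a * Real.cos b)
      else π * (p m * Real.cos b + q m * Real.sin b) := by
  have hseries : IntervalIntegrable
      (fun t => (∑' j, trigTerm p q (1 + j) t) * Real.cos (m * t - b)) volume (-π) π :=
    ((continuous_tsum_trigTerm hp hq 1).mul (by fun_prop)).intervalIntegrable _ _
  simp_rw [hf, add_mul]
  rw [intervalIntegral.integral_add (Continuous.intervalIntegrable (by fun_prop) _ _) hseries,
    integral_tsum_trigTerm_mul_cos_sub hp hq, intervalIntegral.integral_const_mul]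
  split_ifs with hm
  · simp only [hm, Nat.cast_zero, zero_mul, zero_sub, Real.cos_neg,
      intervalIntegral.integral_const, smul_eq_mul]
    ring
  · have h := integral_cos_intCast_mul_sub (j := m) (by omega) b
    rw [Int.cast_natCast] at h
    rw [h, mul_zero, zero_add]

lemma cosCoeff_zero_trigSeries (hp : Summable p) (hq : Summable q)
    (hf : ∀ x, f x = a + ∑' j, trigTerm p q (1 + j) x) : cosCoeff f 0 / 2 = a := by
  have h := integral_trigSeries_mul_cos_sub hp hq hf 0 0
  rw [if_pos rfl, Real.cos_zero, mul_one] at h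
  simp_rw [sub_zero] at h
  rw [cosCoeff, h]
  field_simp

lemma cosCoeff_trigSeries (hp : Summable p) (hq : Summable q)
    (hf : ∀ x, f x = a + ∑' j, trigTerm p q (1 + j) x) {m : ℕ} (hm : m ≠ 0) :
    cosCoeff f m = p m := by
  have h := integral_trigSeries_mul_cos_sub hp hq hf m 0
  rw [if_neg hm, Real.cos_zero, Real.sin_zero, mul_one, mul_zero, add_zero] at h
  simp_rw [sub_zero] at h
  rw [cosCoeff, h]
  field_simp

lemma sinCoeff_trigSeries (hp : Summable p) (hq : Summable q)
    (hf : ∀ x, f x = a + ∑' j, trigTerm p q (1 + j) x) {m : ℕ} (hm : m ≠ 0) :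
    sinCoeff f m = q m := by
  have h := integral_trigSeries_mul_cos_sub hp hq hf m (π / 2)
  rw [if_neg hm, Real.cos_pi_div_two, Real.sin_pi_div_two, mul_one, mul_zero, zero_add] at h
  simp_rw [Real.cos_sub_pi_div_two] at h
  rw [sinCoeff, h]
  field_simp

lemma trigSeries_sub_fourierSum (hp : Summable p) (hq : Summable q)
    (hf : ∀ x, f x = a + ∑' j, trigTerm p q (1 + j) x) (m : ℕ) (x : ℝ) :
    f x - fourierSum m f x = ∑' j, trigTerm p q (m + 1 + j) x := by
  have hsum : Summable fun j => trigTerm p q (1 + j) x :=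
    .of_norm_bounded (summable_abs_add_abs_tail hp hq 1) fun _ => abs_trigTerm_le p q _ _
  have hpartial : fourierSum m f x = a + ∑ j ∈ Finset.range m, trigTerm p q (1 + j) x := by
    rw [fourierSum, cosCoeff_zero_trigSeries hp hq hf, ← Finset.Ico_succ_right_eq_Icc,
      Finset.sum_Ico_eq_sum_range]
    congr! 2 with j
    rw [cosCoeff_trigSeries hp hq hf (by omega), sinCoeff_trigSeries hp hq hf (by omega), trigTerm]
  rw [hpartial, hf, ← hsum.sum_add_tsum_nat_add m, ← add_assoc, add_sub_cancel_left]
  congr! 3 with j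
  ring

end TrigSeries

section Convolution

variable {ψ : ℕ → ℝ}

lemma abs_integral_mul_le_integral_abs {g φ : ℝ → ℝ} (hg : ∀ t, |g t| ≤ 1)
    (hφ : IntervalIntegrable φ volume (-π) π) :
    |∫ t in (-π)..π, g t * φ t| ≤ ∫ t in (-π)..π, |φ t| := by
  rw [← Real.norm_eq_abs]
  refine intervalIntegral.norm_integral_le_of_norm_le (by linarith [Real.pi_pos])
    (ae_of_all _ fun t _ => ?_) hφ.abs
  rw [norm_mul, Real.norm_eq_abs, Real.norm_eq_abs]
  exact mul_le_of_le_one_left (abs_nonneg _) (hg t)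

lemma summable_mul_integral_mul (hψ : Summable ψ) {g : ℕ → ℝ → ℝ} (hg : ∀ k t, |g k t| ≤ 1)
    {φ : ℝ → ℝ} (hφ : IntervalIntegrable φ volume (-π) π) :
    Summable fun k => ψ k * ∫ t in (-π)..π, g k t * φ t := by
  refine .of_norm_bounded (hψ.abs.mul_right (∫ t in (-π)..π, |φ t|)) fun k => ?_
  rw [norm_mul, Real.norm_eq_abs, Real.norm_eq_abs]
  exact mul_le_mul_of_nonneg_left (abs_integral_mul_le_integral_abs (hg k) hφ) (abs_nonneg _)

lemma integral_cos_mul_sub_sub_mul (k θ x : ℝ) {φ : ℝ → ℝ} {a b : ℝ}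
    (hφ : IntervalIntegrable φ volume a b) :
    ∫ t in a..b, Real.cos (k * (x - t) - θ) * φ t =
      (∫ t in a..b, Real.cos (k * t + θ) * φ t) * Real.cos (k * x) +
        (∫ t in a..b, Real.sin (k * t + θ) * φ t) * Real.sin (k * x) := by
  have hcos := hφ.continuousOn_mul (g := fun t => Real.cos (k * t + θ)) (by fun_prop)
  have hsin := hφ.continuousOn_mul (g := fun t => Real.sin (k * t + θ)) (by fun_prop)
  rw [← intervalIntegral.integral_mul_const, ← intervalIntegral.integral_mul_const,
    ← intervalIntegral.integral_add (hcos.mul_const _) (hsin.mul_const _)]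
  congr! 2 with t
  rw [show k * (x - t) - θ = k * x - (k * t + θ) by ring, Real.cos_sub]
  ring

lemma convolution_sub_fourierSum (hψ : Summable ψ) {φ f : ℝ → ℝ}
    (hφ : IntervalIntegrable φ volume (-π) π) {a θ : ℝ}
    (hf : ∀ x, f x = a + 1 / π * ∫ t in (-π)..π, cosKernel ψ θ 1 (x - t) * φ t)
    (m : ℕ) (x : ℝ) :
    f x - fourierSum m f x =
      1 / π * ∫ t in (-π)..π, cosKernel ψ θ (m + 1) (x - t) * φ t := by
  set p : ℕ → ℝ := fun k => 1 / π * (ψ k * ∫ t in (-π)..π, Real.cos (k * t + θ) * φ t)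
  set q : ℕ → ℝ := fun k => 1 / π * (ψ k * ∫ t in (-π)..π, Real.sin (k * t + θ) * φ t)
  have hp : Summable p :=
    (summable_mul_integral_mul hψ (fun _ _ => Real.abs_cos_le_one _) hφ).mul_left _
  have hq : Summable q :=
    (summable_mul_integral_mul hψ (fun _ _ => Real.abs_sin_le_one _) hφ).mul_left _
  have hseries (n : ℕ) (x : ℝ) : 1 / π * ∫ t in (-π)..π, cosKernel ψ θ n (x - t) * φ t =
      ∑' j, trigTerm p q (n + j) x := by
    rw [integral_cosKernel_mul hψ θ n x hφ, ← tsum_mul_left]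
    congr! 2 with j
    rw [integral_cos_mul_sub_sub_mul _ θ x hφ]
    simp only [trigTerm, p, q]
    ring
  rw [hseries]
  exact trigSeries_sub_fourierSum hp hq (fun x => by rw [hf, hseries]) m x

end Convolution

section ZeroMeanBall

variable {φ : ℝ → ℝ}

lemma intervalIntegrable_of_mem_zeroMeanBall_top (hφ : φ ∈ zeroMeanBall ⊤) :
    IntervalIntegrable φ volume (-π) π := by
  obtain ⟨-, hmeas, hnorm, -⟩ := hφ
  rw [intervalIntegrable_iff_integrableOn_Ioc_of_le (by linarith [Real.pi_pos])]
  exact MemLp.integrable le_top ⟨hmeas, hnorm.trans_lt ENNReal.one_lt_top⟩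

lemma ae_abs_le_one_of_mem_zeroMeanBall_top (hφ : φ ∈ zeroMeanBall ⊤) :
    ∀ᵐ t, t ∈ Set.Ioc (-π) π → |φ t| ≤ 1 := by
  obtain ⟨-, -, hnorm, -⟩ := hφ
  rw [eLpNorm_exponent_top] at hnorm
  rw [← ae_restrict_iff' measurableSet_Ioc]
  filter_upwards [ae_le_eLpNormEssSup (f := φ) (μ := volume.restrict (Set.Ioc (-π) π))] with t ht
  simpa [Real.enorm_eq_ofReal_abs] using ht.trans hnorm

lemma abs_integral_mul_le_of_mem_zeroMeanBall_top (hφ : φ ∈ zeroMeanBall ⊤) {K : ℝ → ℝ}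
    (hK : Continuous K) : |∫ t in (-π)..π, K t * φ t| ≤ ∫ t in (-π)..π, |K t| := by
  rw [← Real.norm_eq_abs]
  refine intervalIntegral.norm_integral_le_of_norm_le (by linarith [Real.pi_pos]) ?_
    (hK.abs.intervalIntegrable _ _)
  filter_upwards [ae_abs_le_one_of_mem_zeroMeanBall_top hφ] with t ht htπ
  rw [norm_mul, Real.norm_eq_abs, Real.norm_eq_abs]
  exact mul_le_of_le_one_right (abs_nonneg _) (ht htπ)

end ZeroMeanBall

lemma integral_abs_cosKernel_sub (ψ : ℕ → ℝ) (θ : ℝ) (n : ℕ) (x : ℝ) :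
    ∫ t in (-π)..π, |cosKernel ψ θ n (x - t)| = ∫ t in (-π)..π, |cosKernel ψ θ n t| := by
  have hper : Function.Periodic (fun t => |cosKernel ψ θ n t|) (2 * π) :=
    (cosKernel_periodic ψ θ n).comp abs
  rw [intervalIntegral.integral_comp_sub_left (fun t => |cosKernel ψ θ n t|)]
  convert hper.intervalIntegral_add_eq (x - π) (-π) using 2 <;> ring

/-- The multiplier `exp (-α k ^ r)` that defines the generalized Poisson kernel. -/
noncomputable def poissonCoeff (α r : ℝ) (k : ℕ) : ℝ := Real.exp (-α * (k : ℝ) ^ r)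

section PoissonClass

variable {α r : ℝ} {n : ℕ}

lemma poissonKernel_eq_cosKernel (α r β t : ℝ) :
    poissonKernel α r β t = cosKernel (poissonCoeff α r) (β * π / 2) 1 t := by
  simp only [poissonKernel, cosKernel, poissonCoeff, Nat.cast_add, Nat.cast_one, add_comm]

lemma poissonClass_sub_fourierSum (hψ : Summable (poissonCoeff α r)) (hn : n ≠ 0) {a₀ β : ℝ}
    {φ f : ℝ → ℝ} (hφ : φ ∈ zeroMeanBall ⊤)
    (hf : ∀ x, f x = a₀ / 2 + 1 / π * ∫ t in (-π)..π, poissonKernel α r β (x - t) * φ t) (x : ℝ) :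
    f x - fourierSum (n - 1) f x =
      1 / π * ∫ t in (-π)..π, cosKernel (poissonCoeff α r) (β * π / 2) n (x - t) * φ t := by
  simp_rw [poissonKernel_eq_cosKernel] at hf
  rw [convolution_sub_fourierSum hψ (intervalIntegrable_of_mem_zeroMeanBall_top hφ) hf,
    Nat.sub_add_cancel (Nat.one_le_iff_ne_zero.2 hn)]

lemma fourierError_le_integral_abs (hψ : Summable (poissonCoeff α r)) (hn : n ≠ 0) (β : ℝ) :
    fourierError α r β ⊤ n ≤ ENNReal.ofReal
      (1 / π * ∫ t in (-π)..π, |cosKernel (poissonCoeff α r) (β * π / 2) n t|) := by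
  refine iSup₂_le fun f hf => iSup_le fun x => ENNReal.ofReal_le_ofReal ?_
  obtain ⟨a₀, φ, hφ, hf⟩ := hf
  beta_reduce
  rw [poissonClass_sub_fourierSum hψ hn hφ hf x, abs_mul, abs_of_pos (by positivity : 0 < 1 / π),
    ← integral_abs_cosKernel_sub _ _ _ x]
  gcongr
  exact abs_integral_mul_le_of_mem_zeroMeanBall_top hφ
    ((continuous_cosKernel hψ _ n).comp (by fun_prop))

lemma ofReal_integral_le_fourierError (hψ : Summable (poissonCoeff α r)) (hn : n ≠ 0) (β : ℝ)
    {φ : ℝ → ℝ} (hφ : φ ∈ zeroMeanBall ⊤) :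
    ENNReal.ofReal
      (1 / π * ∫ t in (-π)..π, cosKernel (poissonCoeff α r) (-(β * π / 2)) n t * φ t) ≤
      fourierError α r β ⊤ n := by
  set f : ℝ → ℝ := fun x => 0 / 2 + 1 / π * ∫ t in (-π)..π, poissonKernel α r β (x - t) * φ t
  have hf : f ∈ poissonClass α r β ⊤ := ⟨0, φ, hφ, fun _ => rfl⟩
  have herror := poissonClass_sub_fourierSum (f := f) hψ hn hφ (fun _ => rfl) 0
  simp_rw [zero_sub, cosKernel_neg] at herror
  rw [← herror]
  calc ENNReal.ofReal (f 0 - fourierSum (n - 1) f 0)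
      ≤ ENNReal.ofReal |f 0 - fourierSum (n - 1) f 0| :=
        ENNReal.ofReal_le_ofReal (le_abs_self _)
    _ ≤ uniformNorm fun x => f x - fourierSum (n - 1) f x :=
        le_iSup (fun x => ENNReal.ofReal |f x - fourierSum (n - 1) f x|) 0
    _ ≤ fourierError α r β ⊤ n :=
        le_iSup₂ (f := fun f (_ : f ∈ poissonClass α r β ⊤) =>
          uniformNorm fun x => f x - fourierSum (n - 1) f x) f hf

end PoissonClass

lemma antitone_sub_succ_of_convexOn {f : ℝ → ℝ} (hf : ConvexOn ℝ (Set.Ici 0) f) (n : ℕ) :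
    Antitone fun j : ℕ => f (n + j : ℕ) - f (n + (j + 1) : ℕ) := by
  refine antitone_nat_of_succ_le fun j => ?_
  have hslope := hf.slope_mono_adjacent (x := (n + j : ℕ)) (y := (n + (j + 1) : ℕ))
    (z := (n + (j + 1 + 1) : ℕ)) (Set.mem_Ici.2 (Nat.cast_nonneg _))
    (Set.mem_Ici.2 (Nat.cast_nonneg _)) (Nat.cast_lt.2 (by omega)) (Nat.cast_lt.2 (by omega))
  push_cast at hslope ⊢
  ring_nf at hslope ⊢
  linarith

lemma mul_rpow_mul_rpow_one_sub_div {c x : ℝ} (hc : c ≠ 0) (hx : 0 < x) (r : ℝ) :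
    c * x ^ r * (x ^ (1 - r) / c) = x := by
  calc c * x ^ r * (x ^ (1 - r) / c) = x ^ r * x ^ (1 - r) := by field_simp
    _ = x := by rw [← Real.rpow_add hx, add_sub_cancel, Real.rpow_one]

section Coefficients

variable {α r : ℝ}

lemma convexOn_exp_neg_mul_rpow (hα : 0 ≤ α) (hr : 0 ≤ r) (hr1 : r ≤ 1) :
    ConvexOn ℝ (Set.Ici 0) fun x : ℝ => Real.exp (-α * x ^ r) := by
  refine ⟨convex_Ici 0, fun x hx y hy a b ha hb hab => ?_⟩
  calc Real.exp (-α * (a • x + b • y) ^ r)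
      ≤ Real.exp (a • (-α * x ^ r) + b • (-α * y ^ r)) := by
        have hconcave := (Real.concaveOn_rpow hr hr1).2 hx hy ha hb hab
        simp only [smul_eq_mul] at hconcave ⊢
        rw [Real.exp_le_exp]
        nlinarith
    _ ≤ a • Real.exp (-α * x ^ r) + b • Real.exp (-α * y ^ r) :=
        convexOn_exp.2 (Set.mem_univ _) (Set.mem_univ _) ha hb hab

lemma hasDerivAt_exp_neg_mul_rpow (α r : ℝ) {x : ℝ} (hx : 0 < x) :
    HasDerivAt (fun x : ℝ => Real.exp (-α * x ^ r))
      (-(α * r * x ^ (r - 1) * Real.exp (-α * x ^ r))) x := by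
  convert ((Real.hasDerivAt_rpow_const (Or.inl hx.ne')).const_mul (-α)).exp using 1
  ring

lemma hasDerivAt_rpow_mul_exp_neg_mul_rpow (α r : ℝ) {x : ℝ} (hx : 0 < x) :
    HasDerivAt (fun x : ℝ => x ^ (1 - r) * Real.exp (-α * x ^ r))
      (((1 - r) / x ^ r - α * r) * Real.exp (-α * x ^ r)) x := by
  have hinv : x ^ (1 - r) * x ^ (r - 1) = 1 := by
    rw [← Real.rpow_add hx, sub_add_sub_cancel, sub_self, Real.rpow_zero]
  refine ((Real.hasDerivAt_rpow_const (p := 1 - r) (Or.inl hx.ne')).mul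
    (hasDerivAt_exp_neg_mul_rpow α r hx)).congr_deriv ?_
  rw [sub_sub_cancel_left, Real.rpow_neg hx.le]
  linear_combination -(α * r * Real.exp (-α * x ^ r)) * hinv

-- `x ^ (1 - r) exp (-α x ^ r) / (α r)` is the leading term of the tail integral of
-- `exp (-α x ^ r)`; twice this term has a derivative that dominates the integrand.
lemma exp_neg_mul_add_one_rpow_le (hα : 0 < α) (hr : 0 < r) {x : ℝ} (hx : 0 < x)
    (hp : 2 ≤ α * r * x ^ r) :
    Real.exp (-α * (x + 1) ^ r) ≤
      2 / (α * r) * (x ^ (1 - r) * Real.exp (-α * x ^ r) -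
        (x + 1) ^ (1 - r) * Real.exp (-α * (x + 1) ^ r)) := by
  have hderiv (y : ℝ) (hy : x ≤ y) := hasDerivAt_rpow_mul_exp_neg_mul_rpow α r (hx.trans_le hy)
  obtain ⟨y, ⟨hxy, hyx⟩, hy⟩ := exists_hasDerivAt_eq_slope _ _ (lt_add_one x)
    (fun y hy => (hderiv y hy.1).continuousAt.continuousWithinAt) fun y hy => hderiv y hy.1.le
  have hpow : x ^ r ≤ y ^ r := Real.rpow_le_rpow hx.le hxy.le hr.le
  have hyr : 0 < y ^ r := Real.rpow_pos_of_pos (hx.trans hxy) r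
  have hslope : 1 ≤ 2 / (α * r) * (α * r - (1 - r) / y ^ r) := by
    have hαr : 0 < α * r := mul_pos hα hr
    have hp' : 2 ≤ α * r * y ^ r := hp.trans (by gcongr)
    rw [div_mul_eq_mul_div, one_le_div hαr, mul_sub, le_sub_iff_add_le, mul_div_assoc',
      ← le_sub_iff_add_le', div_le_iff₀ hyr]
    nlinarith
  rw [add_sub_cancel_left, div_one] at hy
  calc Real.exp (-α * (x + 1) ^ r) ≤ Real.exp (-α * y ^ r) := by
        rw [Real.exp_le_exp, neg_mul, neg_mul, neg_le_neg_iff]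
        gcongr
        exact (hx.trans hxy).le
    _ ≤ 2 / (α * r) * (α * r - (1 - r) / y ^ r) * Real.exp (-α * y ^ r) :=
        le_mul_of_one_le_left (Real.exp_nonneg _) hslope
    _ = _ := by linear_combination -(2 / (α * r)) * hy

lemma sum_range_poissonCoeff_le (hα : 0 < α) (hr : 0 < r) {n : ℕ}
    (hp : 2 ≤ α * r * (n : ℝ) ^ r) (hn : n ≠ 0) (N : ℕ) :
    ∑ j ∈ Finset.range N, poissonCoeff α r (n + (j + 1)) ≤
      2 * ((n : ℝ) ^ (1 - r) / (α * r)) * poissonCoeff α r n := by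
  set H : ℕ → ℝ := fun j =>
    2 / (α * r) * ((n + j : ℕ) ^ (1 - r) * poissonCoeff α r (n + j)) with hH
  have hstep (j : ℕ) : poissonCoeff α r (n + (j + 1)) ≤ H j - H (j + 1) := by
    have hmono : (n : ℝ) ^ r ≤ ((n + j : ℕ) : ℝ) ^ r :=
      Real.rpow_le_rpow (Nat.cast_nonneg _) (Nat.cast_le.2 (Nat.le_add_right _ _)) hr.le
    have h := exp_neg_mul_add_one_rpow_le hα hr (x := (n + j : ℕ))
      (Nat.cast_pos.2 (by omega)) (hp.trans (by gcongr))
    rw [mul_sub, ← Nat.cast_succ] at h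
    exact h
  have hHN : 0 ≤ H N := by
    simp only [hH, poissonCoeff]
    positivity
  calc ∑ j ∈ Finset.range N, poissonCoeff α r (n + (j + 1))
      ≤ ∑ j ∈ Finset.range N, (H j - H (j + 1)) := Finset.sum_le_sum fun j _ => hstep j
    _ = H 0 - H N := Finset.sum_range_sub' H N
    _ ≤ H 0 := sub_le_self _ hHN
    _ = 2 * ((n : ℝ) ^ (1 - r) / (α * r)) * poissonCoeff α r n := by
        simp only [hH, add_zero]
        ring

lemma poissonCoeff_sub_succ_le (hα : 0 ≤ α) (hr : 0 ≤ r) (hr1 : r ≤ 1) {n : ℕ} (hn : n ≠ 0) :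
    poissonCoeff α r n - poissonCoeff α r (n + 1) ≤
      poissonCoeff α r n / ((n : ℝ) ^ (1 - r) / (α * r)) := by
  have hn0 : (0 : ℝ) < n := Nat.cast_pos.2 (Nat.pos_of_ne_zero hn)
  have hslope := (convexOn_exp_neg_mul_rpow hα hr hr1).le_slope_of_hasDerivAt
    (Set.mem_Ici.2 hn0.le) (Set.mem_Ici.2 (Nat.cast_nonneg (n + 1))) (Nat.cast_lt.2 n.lt_succ_self)
    (hasDerivAt_exp_neg_mul_rpow α r hn0)
  rw [slope_def_field, Nat.cast_succ, add_sub_cancel_left, div_one] at hslope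
  rw [div_div_eq_mul_div, ← neg_sub r 1, Real.rpow_neg hn0.le, div_inv_eq_mul, poissonCoeff,
    poissonCoeff, Nat.cast_succ]
  linarith

lemma convexTail_poissonCoeff (hα : 0 < α) (hr : 0 < r) (hr1 : r ≤ 1) {n : ℕ}
    (hp : 2 ≤ α * r * (n : ℝ) ^ r) (hM : α * r ≤ (n : ℝ) ^ (1 - r)) :
    ConvexTail (poissonCoeff α r) n ((n : ℝ) ^ (1 - r) / (α * r)) := by
  have hαr : 0 < α * r := mul_pos hα hr
  have hn : n ≠ 0 := by
    rintro rfl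
    norm_num [Real.zero_rpow hr.ne'] at hp
  have hsum := sum_range_poissonCoeff_le hα hr hp hn
  have hnonneg (j : ℕ) : 0 ≤ poissonCoeff α r (n + (j + 1)) := Real.exp_nonneg _
  have htail : Summable fun j => poissonCoeff α r (n + (j + 1)) :=
    summable_of_sum_range_le hnonneg hsum
  have htail' : Summable fun j => poissonCoeff α r (n + j) := (summable_nat_add_iff 1).1 htail
  refine ⟨(summable_nat_add_iff n).1 (by simpa only [add_comm n] using htail'),
    antitone_sub_succ_of_convexOn (convexOn_exp_neg_mul_rpow hα.le hr.le hr1) n,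
    poissonCoeff_sub_succ_le hα.le hr.le hr1 hn, ?_, (one_le_div hαr).2 hM, ?_⟩
  · rw [htail'.tsum_eq_zero_add, add_zero, add_mul, one_mul]
    gcongr
    exact Real.tsum_le_of_sum_range_le hnonneg hsum
  · calc 2 * ((n : ℝ) ^ (1 - r) / (α * r))
        ≤ α * r * (n : ℝ) ^ r * ((n : ℝ) ^ (1 - r) / (α * r)) := by gcongr
      _ = n := mul_rpow_mul_rpow_one_sub_div hαr.ne' (Nat.cast_pos.2 (Nat.pos_of_ne_zero hn)) r

end Coefficients

section Threshold

lemma two_le_and_one_le_of_add_log_le {p M : ℝ} (hp : 0 < p) (hM : 0 < M) (hpM : 1 ≤ p * M)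
    (h : 1 / p * (1 + Real.log (π * M)) + 1 / M ≤ 1 / 2) : 2 ≤ p ∧ 1 ≤ M := by
  have hlog := Real.one_sub_inv_le_log_of_pos (x := π * M) (by positivity)
  have hinv : (π * M)⁻¹ ≤ 1 / 3 * (1 / M) := by
    rw [mul_inv, ← one_div, ← one_div]
    gcongr
    exact Real.pi_gt_three.le
  have hprod : 1 / p * (1 / M) ≤ 1 := by
    rw [one_div_mul_one_div]
    exact div_le_one_of_le₀ hpM (by positivity)
  have hM1 : 1 / M ≤ 1 := by nlinarith [one_div_pos.2 hp]
  have hp2 : 1 / p ≤ 1 / 2 := by nlinarith [one_div_pos.2 hp, one_div_pos.2 hM]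
  exact ⟨(one_div_le_one_div hp two_pos).1 hp2, (div_le_one hM).1 hM1⟩

lemma two_le_and_le_of_threshold_le {α r : ℝ} (hα : 0 < α) (hr : 0 < r) (hr1 : r < 1) {n : ℕ}
    (hn : threshold α r ≤ n) : 2 ≤ α * r * (n : ℝ) ^ r ∧ α * r ≤ (n : ℝ) ^ (1 - r) := by
  obtain ⟨hm1, hm⟩ := (threshold_isLeast hα hr hr1).1
  set m := threshold α r
  have hαr : 0 < α * r := mul_pos hα hr
  have hm0 : (0 : ℝ) < m := Nat.cast_pos.2 hm1
  have hmn : (m : ℝ) ≤ n := Nat.cast_le.2 hn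
  have hconst : 1 / (3 * π) ^ 3 ≤ 1 / 2 := by
    have h : (2 : ℝ) ^ 3 ≤ (3 * π) ^ 3 := by
      gcongr
      linarith [Real.pi_gt_three]
    exact one_div_le_one_div_of_le two_pos (by linarith)
  have hscales : 2 ≤ α * r * (m : ℝ) ^ r ∧ 1 ≤ (m : ℝ) ^ (1 - r) / (α * r) := by
    refine two_le_and_one_le_of_add_log_le (by positivity) (by positivity) ?_ ?_
    · rw [mul_rpow_mul_rpow_one_sub_div hαr.ne' hm0]
      exact Nat.one_le_cast.2 hm1
    · refine le_trans (le_of_eq ?_) (hm.trans hconst)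
      rw [one_div_mul_one_div, one_div_div, mul_div_assoc π]
  refine ⟨hscales.1.trans (by gcongr), ((one_le_div hαr).1 hscales.2).trans ?_⟩
  exact Real.rpow_le_rpow hm0.le hmn (sub_nonneg.2 hr1.le)

end Threshold

namespace ConvexTail

variable {α r M : ℝ} {n : ℕ}

lemma fourierError_le (h : ConvexTail (poissonCoeff α r) n M) (β : ℝ) :
    fourierError α r β ⊤ n ≤ ENNReal.ofReal
      (1 / π * (poissonCoeff α r n * (4 / π * Real.log (π * M) + 54))) :=
  (fourierError_le_integral_abs h.summable h.ne_zero β).trans <| ENNReal.ofReal_le_ofReal <| by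
    gcongr
    exact h.integral_abs_cosKernel_le _

lemma le_fourierError (h : ConvexTail (poissonCoeff α r) n M) (β : ℝ) :
    ENNReal.ofReal (1 / π * (poissonCoeff α r n * (4 / π * Real.log (π * M) - 58))) ≤
      fourierError α r β ⊤ n := by
  obtain ⟨φ, hφ, hle⟩ := h.exists_mem_zeroMeanBall_le_integral (-(β * π / 2))
  refine le_trans (ENNReal.ofReal_le_ofReal ?_)
    (ofReal_integral_le_fourierError h.summable h.ne_zero β hφ)
  gcongr

lemma fourierError_ne_top (h : ConvexTail (poissonCoeff α r) n M) (β : ℝ) :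
    fourierError α r β ⊤ n ≠ ⊤ :=
  ((h.fourierError_le β).trans_lt ENNReal.ofReal_lt_top).ne

lemma abs_toReal_fourierError_sub_le (h : ConvexTail (poissonCoeff α r) n M) (β : ℝ) :
    |(fourierError α r β ⊤ n).toReal - 4 / π ^ 2 * poissonCoeff α r n * Real.log (π * M)| ≤
      20 * poissonCoeff α r n := by
  have hψ : 0 < poissonCoeff α r n := Real.exp_pos _
  have hlog : 0 ≤ Real.log (π * M) :=
    Real.log_nonneg (by nlinarith [h.one_le, Real.pi_gt_three])
  have hupper := ENNReal.toReal_le_of_le_ofReal (by positivity) (h.fourierError_le β)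
  have hlower := (ENNReal.ofReal_le_iff_le_toReal (h.fourierError_ne_top β)).1 (h.le_fourierError β)
  have hexpand (c : ℝ) : 1 / π * (poissonCoeff α r n * (4 / π * Real.log (π * M) + c)) =
      4 / π ^ 2 * poissonCoeff α r n * Real.log (π * M) + c / π * poissonCoeff α r n := by
    field_simp
  have hconst (c : ℝ) (hc : c ≤ 58) : c / π * poissonCoeff α r n ≤ 20 * poissonCoeff α r n := by
    gcongr
    rw [div_le_iff₀ Real.pi_pos]
    linarith [Real.pi_gt_three]
  rw [hexpand] at hupper
  rw [sub_eq_add_neg, hexpand, neg_div] at hlower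
  rw [abs_le]
  constructor <;> linarith [hconst 54 (by norm_num), hconst 58 le_rfl]

end ConvexTail

end FourierApprox

theorem theorem3_general (α r β : ℝ) (hα : 0 < α) (hr : 0 < r) (hr1 : r ≤ 1) (n : ℕ)
    (hp : 2 ≤ α * r * (n : ℝ) ^ r) (hM : α * r ≤ (n : ℝ) ^ (1 - r)) :
    ∃ γ : ℝ, |γ| ≤ 20 ∧
      FourierApprox.fourierError α r β ⊤ n ≠ ⊤ ∧
      (FourierApprox.fourierError α r β ⊤ n).toReal =
        4 / Real.pi ^ 2 * Real.exp (-α * (n : ℝ) ^ r) *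
            Real.log (Real.pi * (n : ℝ) ^ (1 - r) / (α * r)) +
          γ * Real.exp (-α * (n : ℝ) ^ r) := by
  have h := FourierApprox.convexTail_poissonCoeff hα hr hr1 hp hM
  have hbound := h.abs_toReal_fourierError_sub_le β
  rw [← mul_div_assoc, FourierApprox.poissonCoeff] at hbound
  have hexp : 0 < Real.exp (-α * (n : ℝ) ^ r) := Real.exp_pos _
  set E := (FourierApprox.fourierError α r β ⊤ n).toReal
  set A := 4 / π ^ 2 * Real.exp (-α * (n : ℝ) ^ r) * Real.log (π * (n : ℝ) ^ (1 - r) / (α * r))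
  refine ⟨(E - A) / Real.exp (-α * (n : ℝ) ^ r), ?_, h.fourierError_ne_top β, ?_⟩
  · rwa [abs_div, abs_of_pos hexp, div_le_iff₀ hexp]
  · rw [div_mul_cancel₀ _ hexp.ne', add_sub_cancel]

theorem theorem3 (α r β : ℝ) (hα : 0 < α) (hr : 0 < r) (hr1 : r < 1)
    (n : ℕ) (hn : FourierApprox.threshold α r ≤ n) :
    ∃ γ : ℝ, |γ| ≤ 20 * Real.pi ^ 4 ∧
      FourierApprox.fourierError α r β ⊤ n ≠ ⊤ ∧
      (FourierApprox.fourierError α r β ⊤ n).toReal =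
        4 / Real.pi ^ 2 * Real.exp (-α * (n : ℝ) ^ r) *
            Real.log (Real.pi * (n : ℝ) ^ (1 - r) / (α * r)) +
          γ * Real.exp (-α * (n : ℝ) ^ r) := by
  obtain ⟨hp, hM⟩ := FourierApprox.two_le_and_le_of_threshold_le hα hr hr1 hn
  have hπ : 1 ≤ Real.pi ^ 4 := one_le_pow₀ (by linarith [Real.pi_gt_three])
  exact (theorem3_general α r β hα hr hr1.le n hp hM).imp fun γ hγ =>
    ⟨hγ.1.trans (le_mul_of_one_le_right (by norm_num) hπ), hγ.2⟩
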